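/- Let $K/k$ be a Galois extension of number fields with Galois group $G$, and consider the ring of integers $\mathcal{O}_K$ as a $\mathbb{Z}[G]$-module. Definitions. A function $f$ from the set of subgroups of $G$ to an abelian group $X$ is factorisable if there are an injective homomorphism $\iota\colon X\to Y$ of abelian groups and a function $g\colon \mathrm{Irr}(G)\to Y$ on the irreducible complex characters of $G$ such that $\iota(f(H))=\prod_{\chi\in \mathrm{Irr}(G)} g(\chi)^{\langle \chi,\mathbb{C}[G/H]\rangle}$ for all $H\le G$. Two finitely generated $\mathbb{Z}[G]$-modules $M,N$ are factor equivalent if $M\otimes\mathbb{Q}\cong N\otimes\mathbb{Q}$ as $\mathbb{Q}[G]$-modules and, for a homomorphism $i\colon M\to N$ of $\mathbb{Z}[G]$-modules with finite kernel and cokernel (such an $i$ exists, and the notion is required to hold for every such $i$), the function $H\mapsto [N^H:i(M^H)]\cdot|\ker(i)^H|^{-1}\in\mathbb{Q}^\times$ is factorisable. A Brauer relation of $G$ is a formal combination $\Theta=\sum_{H\le G} n_H H$ with $n_H\in\mathbb{Z}$ such that $\bigoplus_{n_H>0}\mathbb{Q}[G/H]^{\oplus n_H}\cong\bigoplus_{n_H<0}\mathbb{Q}[G/H]^{\oplus(-n_H)}$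 as $\mathbb{Q}[G]$-modules. For a $G$-invariant $\mathbb{Z}$-bilinear pairing $\langle\cdot,\cdot\rangle\colon M\times M\to\mathbb{C}$ that is non-degenerate on $M/\mathrm{tors}$ (its determinant on a $\mathbb{Z}$-basis of $M/\mathrm{tors}$ is non-zero), the regulator constant is $\mathcal{C}_\Theta(M)=\prod_{H\le G}\det\bigl(\tfrac{1}{|H|}\langle\cdot,\cdot\rangle\,\big|\,M^H/\mathrm{tors}\bigr)^{n_H}$. Theorem. (1) $\mathcal{O}_K$ is factor equivalent to $\mathbb{Z}[G]^{\oplus[k:\mathbb{Q}]}$. (2) $\mathcal{C}_\Theta(\mathcal{O}_K)=1$ for every Brauer relation $\Theta$ of $G$, computed with any $G$-invariant non-degenerate pairing on $\mathcal{O}_K$. (3) The pairing $\langle a,b\rangle=\sum_{\tau\colon K\hookrightarrow\mathbb{C}}\tau(a)\tau(b)$ on $\mathcal{O}_K$ is $G$-invariant and non-degenerate, and for every $H\le G$ one has $\det\bigl(\tfrac{1}{|H|}\langle\cdot,\cdot\rangle\,\big|\,\mathcal{O}_K^H\bigr)=\Delta_{K^H}$, the absolute discriminant of the fixed field $K^H$.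 (4) $\prod_{H\le G}\Delta_{K^H}^{\,n_H}=1$ for every Brauer relation $\Theta=\sum_H n_H H$ of $G$. -/

import Mathlib

open scoped TensorProduct

noncomputable section

namespace FactorEq

/-! ### Factorisable functions on the set of subgroups -/

section Factorisable

variable {G : Type*} [Group G]

/-- `Irr(G)`: the set of complex-valued functions on `G` which are the character of some
irreducible finite-dimensional complex representation. -/
abbrev IrrChar (G : Type*) [Group G] : Type _ :=
  {χ : G → ℂ // ∃ (n : ℕ) (ρ : Representation ℂ G (Fin n → ℂ)),
    ρ.IsIrreducible ∧ ρ.character = χ}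

/-- The usual inner product `|G|⁻¹ ∑ χ(g) conj(ψ(g))` of complex functions on a finite group. -/
def charInner [Fintype G] (χ ψ : G → ℂ) : ℂ :=
  (Nat.card G : ℂ)⁻¹ * ∑ g : G, χ g * (starRingEnd ℂ) (ψ g)

/-- The character of the permutation representation `ℂ[G/H]`. -/
def permChar (H : Subgroup G) : G → ℂ :=
  (Representation.ofMulAction ℂ G (G ⧸ H)).character

/-- The set `Irr(G)` of a finite group is finite, so products over it are honest finite
products. -/
instance [Finite G] : Finite (IrrChar G) := by
  classical
  let _ := Fintype.ofFinite G
  have hcard : (Nat.card G : ℂ) ≠ 0 := by exact_mod_cast Nat.card_pos.ne'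
  let _ : Invertible (Nat.card G : ℂ) := invertibleOfNonzero hcard
  have horth : ∀ χ ψ : IrrChar G,
      (Nat.card G : ℂ)⁻¹ * ∑ g : G, χ.1 g * ψ.1 g⁻¹ = if χ = ψ then 1 else 0 := by
    rintro ⟨χ, n, ρ, hρ, rfl⟩ ⟨ψ, m, σ, hσ, rfl⟩
    have h := Representation.char_orthonormal ρ σ
    have h1 := Representation.char_orthonormal ρ ρ
    by_cases hne : ρ.character = σ.character
    · have : (⟨ρ.character, n, ρ, hρ, rfl⟩ : IrrChar G) = ⟨σ.character, m, σ, hσ, rfl⟩ :=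
        Subtype.ext hne
      rw [if_pos this]
      rw [if_pos ⟨Representation.Equiv.refl ρ⟩] at h1
      simpa [← hne] using h1
    · have : ¬ (⟨ρ.character, n, ρ, hρ, rfl⟩ : IrrChar G) = ⟨σ.character, m, σ, hσ, rfl⟩ :=
        fun e => hne (congrArg Subtype.val e)
      rw [if_neg this]
      rw [if_neg (fun ⟨e⟩ => hne (Representation.char_iso e).symm)] at h
      exact h
  have hli : LinearIndependent ℂ (fun χ : IrrChar G => (χ.1 : G → ℂ)) := by
    rw [linearIndependent_iff']
    intro s c hc χ hχ
    have h0 : (Nat.card G : ℂ)⁻¹ * ∑ g : G, (∑ ψ ∈ s, c ψ • ψ.1) g * χ.1 g⁻¹ = 0 := by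
      rw [hc]; simp
    have h2 : (Nat.card G : ℂ)⁻¹ * ∑ g : G, (∑ ψ ∈ s, c ψ • ψ.1) g * χ.1 g⁻¹
        = ∑ ψ ∈ s, c ψ * ((Nat.card G : ℂ)⁻¹ * ∑ g : G, ψ.1 g * χ.1 g⁻¹) := by
      simp only [Finset.sum_apply, Pi.smul_apply, smul_eq_mul, Finset.sum_mul, Finset.mul_sum]
      rw [Finset.sum_comm]
      refine Finset.sum_congr rfl fun ψ _ => Finset.sum_congr rfl fun g _ => ?_
      ring
    rw [h2] at h0
    simp only [horth] at h0
    simpa [hχ] using h0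
  exact hli.finite

/-- A function `f` on the subgroups of a finite group `G` with values in an abelian group `X` is
factorisable if there are an injection `ι : X → Y` of abelian groups and a function
`g : Irr(G) → Y` with `ι (f H) = ∏ χ, g χ ^ ⟨χ, ℂ[G/H]⟩` for all `H`. The family `m` of integers
consists of the inner products `⟨χ, ℂ[G/H]⟩`, by which it is determined. -/
def Factorisable {X : Type} [CommGroup X] [Fintype G] (f : Subgroup G → X) : Prop :=
  ∃ (Y : Type) (_ : CommGroup Y) (ι : X →* Y) (g : IrrChar G → Y) (m : IrrChar G → Subgroup G → ℤ),
    Function.Injective ι ∧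
    (∀ χ H, (m χ H : ℂ) = charInner χ.1 (permChar H)) ∧
    ∀ H, ι (f H) = ∏ᶠ χ : IrrChar G, g χ ^ m χ H

end Factorisable

/-! ### Factor equivalence of `ℤ[G]`-modules -/

section FactorEquivalence

variable {G M N : Type*} [Group G] [AddCommGroup M] [AddCommGroup N]

/-- The fixed submodule `M^H`. -/
def fixedBy (ρ : Representation ℤ G M) (H : Subgroup G) : Submodule ℤ M :=
  Representation.invariants (ρ.comp H.subtype)

/-- `M ⊗ ℚ` and `N ⊗ ℚ` are isomorphic as `ℚ[G]`-modules. -/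
def RationallyIsomorphic (ρ : Representation ℤ G M) (σ : Representation ℤ G N) : Prop :=
  ∃ e : (ℚ ⊗[ℤ] M) ≃ₗ[ℚ] (ℚ ⊗[ℤ] N),
    ∀ g x, e ((ρ g).baseChange ℚ x) = (σ g).baseChange ℚ (e x)

/-- The map of `G`-modules `i` has finite kernel and finite cokernel. -/
def FiniteKerCoker {ρ : Representation ℤ G M} {σ : Representation ℤ G N}
    (i : ρ.IntertwiningMap σ) : Prop :=
  Finite (LinearMap.ker i.toLinearMap) ∧ Finite (N ⧸ LinearMap.range i.toLinearMap)

/-- The number `[N^H : i(M^H)] * |ker(i)^H|⁻¹`. -/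
def indexQuotient {ρ : Representation ℤ G M} {σ : Representation ℤ G N}
    (i : ρ.IntertwiningMap σ) (H : Subgroup G) : ℚ :=
  (((fixedBy ρ H).map i.toLinearMap).toAddSubgroup.relIndex (fixedBy σ H).toAddSubgroup : ℚ) *
    (Nat.card (LinearMap.ker i.toLinearMap ⊓ fixedBy ρ H : Submodule ℤ M) : ℚ)⁻¹

/-- Factor equivalence of two (finitely generated) `ℤ[G]`-modules: `M ⊗ ℚ ≅ N ⊗ ℚ` as
`ℚ[G]`-modules, and `H ↦ [N^H : i(M^H)] * |ker(i)^H|⁻¹`, a function with values in `ℚˣ`, is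
factorisable for a map `i` of `G`-modules with finite kernel and cokernel. The notion does not
depend on `i`; we ask that some `i` exists and that every `i` works. -/
def FactorEquivalent [Fintype G] (ρ : Representation ℤ G M) (σ : Representation ℤ G N) : Prop :=
  RationallyIsomorphic ρ σ ∧
  (∃ i : ρ.IntertwiningMap σ, FiniteKerCoker i) ∧
  ∀ i : ρ.IntertwiningMap σ, FiniteKerCoker i →
    ∃ f : Subgroup G → ℚˣ, (∀ H, (f H : ℚ) = indexQuotient i H) ∧ Factorisable f

end FactorEquivalence

/-! ### Brauer relations and regulator constants -/

section Regulator

variable {G M : Type*} [Group G] [AddCommGroup M]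

/-- The `G`-set `⨆ (G/H)^{n H}` (disjoint union over all subgroups `H`). -/
abbrev MultiCoset (n : Subgroup G → ℕ) : Type _ :=
  Σ p : (Σ H : Subgroup G, Fin (n H)), G ⧸ p.1

/-- The formal combination `∑ Θ(H) H` of subgroups is a Brauer relation: the permutation
representations `⨁ ℚ[G/H]^{Θ(H)}` over `Θ(H) > 0` and `⨁ ℚ[G/H]^{-Θ(H)}` over `Θ(H) < 0` are
isomorphic. -/
def IsBrauerRelation (Θ : Subgroup G → ℤ) : Prop :=
  Nonempty (Representation.Equiv
    (Representation.ofMulAction ℚ G (MultiCoset fun H => (Θ H).toNat))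
    (Representation.ofMulAction ℚ G (MultiCoset fun H => (-Θ H).toNat)))

open Classical in
/-- The determinant of the `ℂ`-valued pairing `B` on `W / tors`, for a submodule `W` of `M`: the
determinant of the matrix `B (b i) (b j)`, where `b` runs over elements of `W` that represent a
`ℤ`-basis of `W / tors`. It does not depend on the choices, since `ℂ` is torsion-free and a change
of basis has determinant `±1`. -/
def pairingDet [Module.Finite ℤ M] (B : M →ₗ[ℤ] M →ₗ[ℤ] ℂ) (W : Submodule ℤ M) : ℂ :=
  let b := Module.Free.chooseBasis ℤ (W ⧸ Submodule.torsion ℤ W)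
  let lift : W ⧸ Submodule.torsion ℤ W → W := Function.surjInv (Submodule.mkQ_surjective _)
  Matrix.det (Matrix.of fun i j => B (lift (b i)) (lift (b j)))

/-- The pairing `B` is `G`-invariant. -/
def IsInvariantPairing (ρ : Representation ℤ G M) (B : M →ₗ[ℤ] M →ₗ[ℤ] ℂ) : Prop :=
  ∀ g x y, B (ρ g x) (ρ g y) = B x y

/-- The pairing `B` is non-degenerate on `M / tors`, that is, its `ℂ`-bilinear extension to
`ℂ ⊗ M` is non-degenerate: its determinant is non-zero. -/
def NondegeneratePairing [Module.Finite ℤ M] (B : M →ₗ[ℤ] M →ₗ[ℤ] ℂ) : Prop :=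
  pairingDet B ⊤ ≠ 0

/-- The determinant of `|H|⁻¹ B` on `M^H / tors`. -/
def fixedDet [Module.Finite ℤ M] (ρ : Representation ℤ G M) (B : M →ₗ[ℤ] M →ₗ[ℤ] ℂ)
    (H : Subgroup G) : ℂ :=
  pairingDet ((Nat.card H : ℂ)⁻¹ • B) (fixedBy ρ H)

/-- The regulator constant `∏ det(|H|⁻¹ B | M^H / tors) ^ Θ(H)`, computed with the
pairing `B`. -/
def regulatorConstant [Module.Finite ℤ M] (ρ : Representation ℤ G M)
    (B : M →ₗ[ℤ] M →ₗ[ℤ] ℂ) (Θ : Subgroup G → ℤ) : ℂ :=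
  ∏ᶠ H : Subgroup G, fixedDet ρ B H ^ Θ H

end Regulator

/-! ### Rings of integers -/

section NumberField

open NumberField

/-- The ring of integers of `K` as a `ℤ[Gal(K/k)]`-module. -/
def ringOfIntegersRep (k K : Type*) [Field k] [Field K] [Algebra k K] :
    Representation ℤ (K ≃ₐ[k] K) (𝓞 K) :=
  Representation.ofDistribMulAction ℤ (K ≃ₐ[k] K) (𝓞 K)

/-- The pairing `⟨a, b⟩ = ∑ τ(a) τ(b)` on the ring of integers, the sum running over all
embeddings `τ` of `K` into `ℂ`. -/
def tracePairing (K : Type*) [Field K] [NumberField K] : 𝓞 K →ₗ[ℤ] 𝓞 K →ₗ[ℤ] ℂ :=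
  LinearMap.mk₂ ℤ (fun a b => ∑ τ : K →+* ℂ, τ (a : K) * τ (b : K))
    (by intro a b c; simp [add_mul, Finset.sum_add_distrib])
    (by intro n a b; simp [Finset.mul_sum, mul_assoc])
    (by intro a b c; simp [mul_add, Finset.sum_add_distrib])
    (by intro n a b; simp [Finset.mul_sum, mul_left_comm])

end NumberField

end FactorEq

end

/-! Call a function on subgroups a mean exponential if it has the form `H ↦ exp(|H|⁻¹ ∑_{h ∈ H}
φ(h))` for a class function `φ`. By Frobenius reciprocity the exponent is the pairing of `φ` with
the character of `ℂ[G/H]`. Hence the alternating product over a Brauer relation is 1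
(`IsMeanExp.finprod_zpow_eq_one`), and expanding that character in irreducibles shows
factorisability (`IsMeanExp.factorisable`). So it suffices to see that the relevant determinants and
indices are mean exponentials.

Two sources supply them. If an automorphism `A` commutes with `G`, then `H ↦ det(A | V^H)` is one,
with `φ = ∑ log μ · (character of the generalised μ-eigenspace)`; since two invariant non-degenerate
pairings differ by such an `A`, the choice of pairing does not matter (`exists_isMeanExp_fixedDet`).
Secondly, `H ↦ |Δ_{K^H}|` is one: Hilbert's formula writes the different of `K/K^H` as the product
over `σ ∈ H`, `σ ≠ 1`, of the ideals generated by all `σx - x`. These ideals depend on `σ` alone,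
not on `H`, so the tower formula for discriminants turns `log |Δ_{K^H}|` into a mean over `H`.

Only the signs remain. An isogeny `i` from `𝓞 K` to a free `ℤ[G]`-module pulls the standard pairing
back to one with determinants `[N^H : i(M^H)]²`, which are positive. Comparison with the trace
pairing, in absolute value, makes these squares mean exponentials; their positive square roots give
factor equivalence. Every other pairing is then compared with the pulled-back one, signs included,
which gives the regulator constants and the discriminant relation. -/

noncomputable section

namespace FactorEq

/-! ### Means of class functions over subgroups, and Brauer relations -/

section Means

variable {G : Type*} [Group G]

/-- The mean of a complex-valued function on a finite group over a subgroup. -/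
def subgroupMean [Fintype G] (φ : G → ℂ) (H : Subgroup G) : ℂ :=
  (Nat.card H : ℂ)⁻¹ * ∑ g : G, (H : Set G).indicator φ g

/-- A function which is constant on conjugacy classes. -/
def IsClassFunction {X : Type*} (φ : G → X) : Prop :=
  ∀ g h, φ (h * g * h⁻¹) = φ g

lemma character_ofMulAction {k X : Type*} [Field k] [MulAction G X] [Finite X] (g : G) :
    (Representation.ofMulAction k G X).character g = (Nat.card {x : X // g • x = x} : k) := by
  classical
  have := Fintype.ofFinite X
  let b : Module.Basis X k (MonoidAlgebra k X) := ⟨MonoidAlgebra.coeffLinearEquiv k⟩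
  have hb : ∀ x, b x = MonoidAlgebra.single x 1 := fun x ↦ rfl
  rw [Representation.character, LinearMap.trace_eq_matrix_trace k b, Matrix.trace]
  have : ∀ x, (LinearMap.toMatrix b b (Representation.ofMulAction k G X g)).diag x =
      if g • x = x then 1 else 0 := by
    intro x
    rw [Matrix.diag_apply, LinearMap.toMatrix_apply, hb, Representation.ofMulAction_single,
      ← hb, b.repr_self, Finsupp.single_apply]
  simp only [this]
  rw [Finset.sum_boole, Nat.card_eq_fintype_card, Fintype.card_subtype]

lemma permChar_apply [Finite G] (H : Subgroup G) (g : G) :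
    permChar H g = (Nat.card {x : G ⧸ H // g • x = x} : ℂ) :=
  character_ofMulAction g

lemma isClassFunction_character {V : Type*} [AddCommGroup V] [Module ℂ V]
    (ρ : Representation ℂ G V) : IsClassFunction ρ.character :=
  fun g h ↦ ρ.char_conj g h

variable [Fintype G]

omit [Fintype G] in
lemma card_smul_quotient_eq (H : Subgroup G) (g : G) :
    Nat.card {x : G ⧸ H // g • x = x} * Nat.card H =
      Nat.card {x : G // x⁻¹ * g * x ∈ H} := by
  classical
  rw [← Nat.card_prod]
  refine Nat.card_congr (Equiv.symm ?_)
  have e : {x : G // x⁻¹ * g * x ∈ H} ≃ {p : (G ⧸ H) × H // g • p.1 = p.1} :=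
    (Subgroup.groupEquivQuotientProdSubgroup (s := H)).subtypeEquiv fun x ↦ by
      change _ ↔ g • (x : G ⧸ H) = x
      rw [eq_comm, MulAction.Quotient.smul_coe, QuotientGroup.eq, smul_eq_mul, mul_assoc]
  exact e.trans (Equiv.prodSubtypeFstEquivSubtypeProd (p := fun x : G ⧸ H ↦ g • x = x))

lemma conj_permChar (H : Subgroup G) (g : G) :
    (starRingEnd ℂ) (permChar H g) = permChar H g := by
  rw [permChar_apply, Complex.conj_natCast]

/-- Frobenius reciprocity for permutation characters. -/
lemma charInner_permChar {φ : G → ℂ} (hφ : IsClassFunction φ) (H : Subgroup G) :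
    charInner φ (permChar H) = subgroupMean φ H := by
  classical
  have hG : (Nat.card G : ℂ) ≠ 0 := by exact_mod_cast Nat.card_pos.ne'
  have hH : (Nat.card H : ℂ) ≠ 0 := by exact_mod_cast Nat.card_pos.ne'
  have h1 : ∀ g, permChar H g * Nat.card H = ∑ x : G, if x⁻¹ * g * x ∈ H then 1 else 0 := by
    intro g
    rw [permChar_apply, ← Nat.cast_mul, card_smul_quotient_eq, Finset.sum_boole,
      Nat.card_eq_fintype_card, Fintype.card_subtype]
  have h3 : (∑ g : G, φ g * permChar H g) * Nat.card H =
      Nat.card G * ∑ g : G, (H : Set G).indicator φ g := by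
    -- After swapping the sums, the substitution `g ↦ x⁻¹ g x` turns the inner sum for each `x` into
    -- the sum of `φ` over `H`, which therefore occurs `|G|` times.
    simp_rw [Finset.sum_mul, mul_assoc, h1, Finset.mul_sum]
    rw [Finset.sum_comm, Nat.card_eq_fintype_card, ← Finset.mul_sum, ← nsmul_eq_mul,
      ← Finset.card_univ, ← Finset.sum_const]
    refine Finset.sum_congr rfl fun x _ ↦ ?_
    refine Fintype.sum_equiv ((MulAut.conj x⁻¹).toEquiv) _ _ fun g ↦ ?_
    have : (MulAut.conj x⁻¹).toEquiv g = x⁻¹ * g * x := by simp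
    rw [this, Set.indicator_apply]
    have := hφ g x⁻¹
    rw [inv_inv] at this
    simp [this]
  simp only [charInner, conj_permChar, subgroupMean]
  field_simp
  linear_combination h3

/-- Isomorphic permutation representations have equal characters, and these count fixed points; the
positive and negative parts of `Θ` are then brought to one side. -/
lemma IsBrauerRelation.sum_permChar {Θ : Subgroup G → ℤ} (hΘ : IsBrauerRelation Θ) (g : G) :
    ∑ H, (Θ H : ℂ) * permChar H g = 0 := by
  classical
  obtain ⟨e⟩ := hΘ
  have h := congrFun (Representation.char_iso e) g
  rw [character_ofMulAction, character_ofMulAction] at h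
  have key : ∀ n : Subgroup G → ℕ, Nat.card {x : MultiCoset n // g • x = x} =
      ∑ H, n H * Nat.card {x : G ⧸ H // g • x = x} := by
    intro n
    have e1 : {x : MultiCoset n // g • x = x} ≃
        Σ p : (Σ H : Subgroup G, Fin (n H)), {x : G ⧸ p.1 // g • x = x} :=
      { toFun := fun x ↦ ⟨x.1.1, x.1.2, by
          obtain ⟨⟨p, x⟩, hx⟩ := x
          rw [Sigma.smul_mk, Sigma.mk.injEq] at hx
          exact eq_of_heq hx.2⟩
        invFun := fun x ↦ ⟨⟨x.1, x.2.1⟩, by rw [Sigma.smul_mk, x.2.2]⟩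
        left_inv := fun x ↦ rfl
        right_inv := fun x ↦ rfl }
    rw [Nat.card_congr e1, Nat.card_sigma, Fintype.sum_sigma]
    refine Finset.sum_congr rfl fun H _ ↦ ?_
    change ∑ _ : Fin (n H), Nat.card {x : G ⧸ H // g • x = x} = _
    rw [Finset.sum_const, Finset.card_univ, Fintype.card_fin, smul_eq_mul]
  rw [key, key] at h
  have h' : ∑ H : Subgroup G, ((Θ H).toNat * Nat.card {x : G ⧸ H // g • x = x} : ℂ) =
      ∑ H : Subgroup G, ((-Θ H).toNat * Nat.card {x : G ⧸ H // g • x = x} : ℂ) := by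
    exact_mod_cast h
  rw [← sub_eq_zero, ← Finset.sum_sub_distrib] at h'
  rw [← h']
  refine Finset.sum_congr rfl fun H _ ↦ ?_
  rw [permChar_apply, ← sub_mul]
  congr 1
  have : Θ H = ((Θ H).toNat : ℤ) - ((-Θ H).toNat : ℤ) := by omega
  exact_mod_cast congrArg (Int.cast : ℤ → ℂ) this

lemma IsBrauerRelation.sum_subgroupMean {Θ : Subgroup G → ℤ} (hΘ : IsBrauerRelation Θ)
    {φ : G → ℂ} (hφ : IsClassFunction φ) : ∑ H, (Θ H : ℂ) * subgroupMean φ H = 0 := by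
  simp_rw [← charInner_permChar hφ, charInner]
  simp only [conj_permChar, Finset.mul_sum]
  rw [Finset.sum_comm]
  refine Finset.sum_eq_zero fun g _ ↦ ?_
  have := congrArg (fun z ↦ (Nat.card G : ℂ)⁻¹ * φ g * z) (hΘ.sum_permChar g)
  simp only [Finset.mul_sum, mul_zero] at this
  rw [← this]
  exact Finset.sum_congr rfl fun H _ ↦ by ring

/-- A function on subgroups which is the exponential of the means of a class function. -/
def IsMeanExp (f : Subgroup G → ℂ) : Prop :=
  ∃ φ : G → ℂ, IsClassFunction φ ∧ ∀ H, f H = Complex.exp (subgroupMean φ H)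

lemma subgroupMean_add (φ ψ : G → ℂ) (H : Subgroup G) :
    subgroupMean (φ + ψ) H = subgroupMean φ H + subgroupMean ψ H := by
  simp only [subgroupMean, Set.indicator_add', Pi.add_apply, Finset.sum_add_distrib, mul_add]

lemma subgroupMean_smul (c : ℂ) (φ : G → ℂ) (H : Subgroup G) :
    subgroupMean (c • φ) H = c * subgroupMean φ H := by
  have : (H : Set G).indicator (c • φ) = c • (H : Set G).indicator φ :=
    Set.indicator_const_smul _ c φ
  simp only [subgroupMean, this, Pi.smul_apply, smul_eq_mul, ← Finset.mul_sum]
  ring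

lemma subgroupMean_zero (H : Subgroup G) : subgroupMean (0 : G → ℂ) H = 0 := by
  simp [subgroupMean]

lemma subgroupMean_sum {ι : Type*} (s : Finset ι) (φ : ι → G → ℂ) (H : Subgroup G) :
    subgroupMean (∑ i ∈ s, φ i) H = ∑ i ∈ s, subgroupMean (φ i) H := by
  classical
  induction s using Finset.induction_on with
  | empty => simp [subgroupMean_zero]
  | insert a s ha ih => rw [Finset.sum_insert ha, Finset.sum_insert ha, subgroupMean_add, ih]

lemma subgroupMean_re (φ : G → ℂ) (H : Subgroup G) :
    subgroupMean (fun g ↦ ((φ g).re : ℂ)) H = ((subgroupMean φ H).re : ℂ) := by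
  classical
  have : (Nat.card H : ℂ)⁻¹ = (((Nat.card H : ℝ)⁻¹ : ℝ) : ℂ) := by push_cast; rfl
  simp only [subgroupMean, this, Complex.re_ofReal_mul, Complex.re_sum]
  push_cast
  congr 1
  refine Finset.sum_congr rfl fun g _ ↦ ?_
  simp only [Set.indicator_apply]
  split_ifs <;> simp

namespace IsMeanExp

variable {f f' : Subgroup G → ℂ}

lemma mul (hf : IsMeanExp f) (hf' : IsMeanExp f') : IsMeanExp fun H ↦ f H * f' H := by
  obtain ⟨φ, hφ, h⟩ := hf
  obtain ⟨ψ, hψ, h'⟩ := hf'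
  refine ⟨φ + ψ, fun g k ↦ by simp [hφ g k, hψ g k], fun H ↦ ?_⟩
  simp only [subgroupMean_add, Complex.exp_add, h, h']

lemma norm (hf : IsMeanExp f) : IsMeanExp fun H ↦ ((‖f H‖ : ℝ) : ℂ) := by
  obtain ⟨φ, hφ, h⟩ := hf
  refine ⟨fun g ↦ ((φ g).re : ℂ), fun g k ↦ by simp [hφ g k], fun H ↦ ?_⟩
  simp only [subgroupMean_re, h, Complex.norm_exp, Complex.ofReal_exp]

/-- A positive function whose square is the exponential of means of a class function is itself
of this form. -/
lemma of_sq {r : Subgroup G → ℝ} (hr : ∀ H, 0 < r H) (hf : IsMeanExp fun H ↦ ((r H : ℂ) ^ 2)) :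
    IsMeanExp fun H ↦ (r H : ℂ) := by
  obtain ⟨φ, hφ, h⟩ := hf.norm
  -- Halving an arbitrary complex exponent fixes the square root only up to a sign depending on `H`.
  -- With the real part both candidates are positive, so they agree.
  refine ⟨(1 / 2 : ℂ) • fun g ↦ ((φ g).re : ℂ), fun g k ↦ by simp [hφ g k], fun H ↦ ?_⟩
  rw [subgroupMean_smul, subgroupMean_re]
  have h1 := congrArg (fun z ↦ ‖z‖) (h H)
  simp only [Complex.norm_real, norm_pow, Complex.norm_exp, Real.norm_eq_abs,
    sq_abs] at h1
  have h2 : r H = Real.exp ((1 / 2) * (subgroupMean φ H).re) := by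
    refine (sq_eq_sq₀ (hr H).le (Real.exp_pos _).le).mp ?_
    rw [h1, ← Real.exp_nat_mul]
    congr 1
    push_cast
    ring
  simp only [h2]
  push_cast
  rfl

lemma finprod_zpow_eq_one (hf : IsMeanExp f) {Θ : Subgroup G → ℤ} (hΘ : IsBrauerRelation Θ) :
    ∏ᶠ H, f H ^ Θ H = 1 := by
  obtain ⟨φ, hφ, h⟩ := hf
  classical
  rw [finprod_eq_prod_of_fintype]
  simp_rw [h, ← Complex.exp_int_mul]
  rw [← Complex.exp_sum, hΘ.sum_subgroupMean hφ, Complex.exp_zero]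

end IsMeanExp

end Means

/-! ### Irreducible characters and factorisability -/

section Characters

variable {G : Type*} [Group G] [Fintype G]

lemma charInner_irrChar (χ ψ : IrrChar G) [Decidable (χ = ψ)] :
    (Nat.card G : ℂ)⁻¹ * ∑ g : G, χ.1 g * ψ.1 g⁻¹ = if χ = ψ then 1 else 0 := by
  have hcard : (Nat.card G : ℂ) ≠ 0 := by exact_mod_cast Nat.card_pos.ne'
  let _ : Invertible (Nat.card G : ℂ) := invertibleOfNonzero hcard
  obtain ⟨χ, n, ρ, hρ, rfl⟩ := χ
  obtain ⟨ψ, m, σ, hσ, rfl⟩ := ψ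
  have h := Representation.char_orthonormal ρ σ
  have h1 := Representation.char_orthonormal ρ ρ
  simp only [Subtype.mk.injEq]
  by_cases hne : ρ.character = σ.character
  · rw [if_pos hne]
    rw [if_pos ⟨Representation.Equiv.refl ρ⟩] at h1
    simpa [← hne] using h1
  · rw [if_neg hne]
    rw [if_neg (fun ⟨e⟩ ↦ hne (Representation.char_iso e).symm)] at h
    exact h

omit [Fintype G] in
lemma character_eq_add_of_isCompl {V : Type*} [AddCommGroup V] [Module ℂ V]
    [FiniteDimensional ℂ V] {ρ : Representation ℂ G V} {p q : Subrepresentation ρ}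
    (h : IsCompl p q) (g : G) :
    ρ.character g = p.toRepresentation.character g + q.toRepresentation.character g := by
  have h' : IsCompl p.toSubmodule q.toSubmodule := by
    constructor
    · rw [disjoint_iff, ← Subrepresentation.toSubmodule_inf, h.inf_eq_bot]; rfl
    · rw [codisjoint_iff, ← Subrepresentation.toSubmodule_sup, h.sup_eq_top]; rfl
  let e := Submodule.prodEquivOfIsCompl _ _ h'
  have : ρ g = e.conj (LinearMap.prodMap (p.toRepresentation g) (q.toRepresentation g)) := by
    refine LinearMap.ext fun v ↦ ?_
    obtain ⟨w, rfl⟩ := e.surjective v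
    rw [LinearEquiv.conj_apply_apply, e.symm_apply_apply]
    simp [e, Submodule.coe_prodEquivOfIsCompl', Subrepresentation.toRepresentation]
  rw [Representation.character, this, LinearMap.trace_conj', LinearMap.trace_prodMap']
  rfl

/-- Every character is a linear combination of irreducible characters. -/
lemma exists_character_eq_sum_irrChar [Fintype (IrrChar G)] {V : Type*} [AddCommGroup V]
    [Module ℂ V] [FiniteDimensional ℂ V] (ρ : Representation ℂ G V) :
    ∃ c : IrrChar G → ℂ, ∀ g, ρ.character g = ∑ χ, c χ * χ.1 g := by
  classical
  induction hn : Module.finrank ℂ V using Nat.strong_induction_on generalizing V with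
  | _ n ih =>
  by_cases htriv : Subsingleton V
  · refine ⟨0, fun g ↦ ?_⟩
    have : ρ g = 0 := Subsingleton.elim _ _
    simp [Representation.character, this]
  by_cases hirr : ρ.IsIrreducible
  -- `IrrChar` refers only to representations on coordinate spaces, so `ρ` is transported to one.
  · let e : V ≃ₗ[ℂ] (Fin (Module.finrank ℂ V) → ℂ) := (Module.finBasis ℂ V).equivFun
    let σ : Representation ℂ G (Fin (Module.finrank ℂ V) → ℂ) :=
      { toFun := fun g ↦ e.conj (ρ g)
        map_one' := by rw [map_one]; exact LinearEquiv.conj_id e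
        map_mul' := fun g h ↦ by rw [map_mul]; exact LinearEquiv.conj_comp e (ρ h) (ρ g) }
    have hchar : σ.character = ρ.character := by
      ext g
      exact LinearMap.trace_conj' (ρ g) e
    have hσ : σ.IsIrreducible := by
      let o : Subrepresentation ρ ≃o Subrepresentation σ :=
        { toFun := fun p ↦ ⟨p.toSubmodule.map e.toLinearMap, by
            rintro g _ ⟨v, hv, rfl⟩
            exact ⟨ρ g v, p.apply_mem_toSubmodule g hv, by
              simp [σ, LinearEquiv.conj_apply_apply]⟩⟩
          invFun := fun p ↦ ⟨p.toSubmodule.comap e.toLinearMap, by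
            intro g v hv
            have := p.apply_mem_toSubmodule g hv
            simpa [σ, LinearEquiv.conj_apply_apply] using this⟩
          left_inv := fun p ↦ by
            apply Subrepresentation.toSubmodule_injective
            exact Submodule.comap_map_eq_of_injective e.injective _
          right_inv := fun p ↦ by
            apply Subrepresentation.toSubmodule_injective
            exact Submodule.map_comap_eq_of_surjective e.surjective _
          map_rel_iff' := fun {p q} ↦ Submodule.map_le_map_iff_of_injective e.injective
            p.toSubmodule q.toSubmodule }
      exact (OrderIso.isSimpleOrder_iff o).mp hirr
    refine ⟨fun χ ↦ if χ = ⟨σ.character, _, σ, hσ, rfl⟩ then 1 else 0, fun g ↦ ?_⟩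
    simp [hchar]
  · obtain ⟨p, hp0, hp1⟩ : ∃ p : Subrepresentation ρ, p ≠ ⊥ ∧ p ≠ ⊤ := by
      by_contra! hcon
      have : Nontrivial (Subrepresentation ρ) := by
        refine ⟨⊥, ⊤, fun h ↦ htriv ?_⟩
        have h' : (⊥ : Submodule ℂ V) = ⊤ := congrArg Subrepresentation.toSubmodule h
        exact (Submodule.subsingleton_iff ℂ).mp (subsingleton_of_bot_eq_top h')
      exact hirr ⟨fun p ↦ or_iff_not_imp_left.mpr (hcon p)⟩
    -- Maschke's theorem: `|G|` is non-zero in `ℂ`, so `p` has a complement, and both summands have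
    -- smaller dimension.
    have : NeZero (Nat.card G : ℂ) := ⟨by exact_mod_cast Nat.card_pos.ne'⟩
    obtain ⟨q, hpq⟩ := exists_isCompl p
    have hq1 : q ≠ ⊤ := fun h ↦ hp0 (by simpa [h] using hpq.inf_eq_bot)
    have hlt : ∀ r : Subrepresentation ρ, r ≠ ⊤ → Module.finrank ℂ r.toSubmodule < n := by
      intro r hr
      rw [← hn]
      refine Submodule.finrank_lt fun h ↦ hr ?_
      exact Subrepresentation.toSubmodule_injective h
    obtain ⟨c, hc⟩ := ih _ (hlt p hp1) p.toRepresentation rfl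
    obtain ⟨d, hd⟩ := ih _ (hlt q hq1) q.toRepresentation rfl
    refine ⟨c + d, fun g ↦ ?_⟩
    rw [character_eq_add_of_isCompl hpq, hc, hd, ← Finset.sum_add_distrib]
    simp [add_mul]

/-- The mean is the trace of the averaging projector onto the `H`-invariants. This gives both the
integrality of `⟨χ, ℂ[G/H]⟩` and the multiplicities in the determinant computation. -/
lemma subgroupMean_character {V : Type*} [AddCommGroup V] [Module ℂ V] [FiniteDimensional ℂ V]
    (ρ : Representation ℂ G V) (H : Subgroup G) :
    subgroupMean ρ.character H =
      Module.finrank ℂ (Representation.invariants (ρ.comp H.subtype)) := by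
  classical
  have hcard : (Nat.card H : ℂ) ≠ 0 := by exact_mod_cast Nat.card_pos.ne'
  let _ : Invertible (Nat.card H : ℂ) := invertibleOfNonzero hcard
  have := Representation.card_inv_mul_sum_char_eq_finrank (ρ.comp H.subtype)
  rw [← this, subgroupMean]
  congr 1
  have h : ∀ g, (H : Set G).indicator ρ.character g = if g ∈ H then ρ.character g else 0 :=
    fun g ↦ Set.indicator_apply _ _ _
  simp_rw [h]
  rw [← Finset.sum_filter]
  exact Finset.sum_subtype _ (by simp) _

lemma permChar_inv (H : Subgroup G) (g : G) : permChar H g⁻¹ = permChar H g := by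
  rw [permChar_apply, permChar_apply]
  congr 1
  refine Nat.card_congr (Equiv.subtypeEquivRight fun x ↦ ?_)
  rw [inv_smul_eq_iff, eq_comm]

omit [Fintype G] in
lemma isClassFunction_irrChar (χ : IrrChar G) : IsClassFunction χ.1 := by
  obtain ⟨_, n, ρ, -, rfl⟩ := χ
  exact isClassFunction_character ρ

lemma permChar_eq_sum_irrChar [Fintype (IrrChar G)] (H : Subgroup G) (g : G) :
    permChar H g = ∑ χ : IrrChar G, charInner χ.1 (permChar H) * χ.1 g := by
  classical
  have : Module.Finite ℂ (MonoidAlgebra ℂ (G ⧸ H)) :=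
    Module.Finite.equiv (MonoidAlgebra.coeffLinearEquiv ℂ).symm
  obtain ⟨c, hc⟩ := exists_character_eq_sum_irrChar (Representation.ofMulAction ℂ G (G ⧸ H))
  have hc' : ∀ g, permChar H g = ∑ χ : IrrChar G, c χ * χ.1 g := hc
  have key : ∀ χ : IrrChar G, charInner χ.1 (permChar H) = c χ := by
    intro χ
    simp only [charInner, conj_permChar]
    have hc2 : ∀ g, permChar H g = ∑ χ : IrrChar G, c χ * χ.1 g⁻¹ :=
      fun g ↦ by rw [← permChar_inv, hc']
    simp_rw [hc2, Finset.mul_sum]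
    rw [Finset.sum_comm]
    have : ∀ ψ : IrrChar G, ∑ g : G, (Nat.card G : ℂ)⁻¹ * (χ.1 g * (c ψ * ψ.1 g⁻¹)) =
        c ψ * if χ = ψ then 1 else 0 := by
      intro ψ
      rw [← charInner_irrChar, Finset.mul_sum, Finset.mul_sum]
      exact Finset.sum_congr rfl fun g _ ↦ by ring
    simp_rw [this]
    simp
  simp_rw [key]
  exact hc' g

/-- The exponential of the means of a class function is factorisable. -/
lemma IsMeanExp.factorisable {f : Subgroup G → ℚˣ}
    (hf : IsMeanExp fun H ↦ (((f H : ℚˣ) : ℚ) : ℂ)) : Factorisable f := by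
  obtain ⟨φ, hφ, h⟩ := hf
  have := Fintype.ofFinite (IrrChar G)
  have hm : ∀ χ : IrrChar G, ∀ H : Subgroup G, ∃ m : ℤ, (m : ℂ) = charInner χ.1 (permChar H) := by
    intro χ H
    rw [charInner_permChar (isClassFunction_irrChar χ)]
    obtain ⟨_, n, ρ, -, rfl⟩ := χ
    exact ⟨_, by rw [subgroupMean_character]; exact Int.cast_natCast _⟩
  choose m hm using hm
  -- The value at `χ` is the exponential of the pairing of `φ` with `χ`, without conjugation,
  -- because the real character of `ℂ[G/H]` is expanded as `∑ ⟨χ, ℂ[G/H]⟩ χ`.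
  refine ⟨ℂˣ, inferInstance, Units.map (algebraMap ℚ ℂ), fun χ ↦ Units.mk0
    (Complex.exp ((Nat.card G : ℂ)⁻¹ * ∑ g, φ g * χ.1 g)) (Complex.exp_ne_zero _), m, ?_, hm, ?_⟩
  · exact Units.map_injective (algebraMap ℚ ℂ).injective
  · intro H
    rw [finprod_eq_prod_of_fintype]
    ext
    have := h H
    simp only [eq_ratCast, Units.coe_map, MonoidHom.coe_coe, Units.coe_prod,
      Units.val_zpow_eq_zpow_val, Units.val_mk0, ← Complex.exp_int_mul, ← Complex.exp_sum] at this ⊢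
    rw [this, ← charInner_permChar hφ]
    congr 1
    simp only [charInner, conj_permChar, Finset.mul_sum, hm]
    rw [Finset.sum_comm]
    refine Finset.sum_congr rfl fun g _ ↦ ?_
    rw [permChar_eq_sum_irrChar, Finset.mul_sum, Finset.mul_sum]
    simp only [charInner, conj_permChar, Finset.mul_sum]
    refine Finset.sum_congr rfl fun χ _ ↦ ?_
    ring

end Characters

/-! ### Determinants of equivariant automorphisms on invariants -/

section Determinants

variable {G : Type*} [Group G] {V : Type*} [AddCommGroup V] [Module ℂ V]

lemma mapsTo_invariants {ρ : Representation ℂ G V} {A : Module.End ℂ V}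
    (hA : ∀ g, Commute A (ρ g)) (H : Subgroup G) :
    ∀ v ∈ Representation.invariants (ρ.comp H.subtype),
      A v ∈ Representation.invariants (ρ.comp H.subtype) := by
  intro v hv h
  exact (LinearMap.congr_fun (hA h) v).symm.trans (congrArg A (hv h))

/-- The generalised eigenspace of an equivariant endomorphism, as a subrepresentation. -/
def maxGenEigenspaceSubrep {ρ : Representation ℂ G V} {A : Module.End ℂ V}
    (hA : ∀ g, Commute A (ρ g)) (μ : ℂ) : Subrepresentation ρ where
  toSubmodule := A.maxGenEigenspace μ
  apply_mem_toSubmodule g _ hv := Module.End.mapsTo_maxGenEigenspace_of_comm (hA g) μ hv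

variable [FiniteDimensional ℂ V]

/-- Inside `V`, both sides measure the intersection of `V^H` with the generalised eigenspace. -/
lemma finrank_invariants_maxGenEigenspaceSubrep {ρ : Representation ℂ G V} {A : Module.End ℂ V}
    (hA : ∀ g, Commute A (ρ g)) (μ : ℂ) (H : Subgroup G) :
    Module.finrank ℂ (Representation.invariants
        ((maxGenEigenspaceSubrep hA μ).toRepresentation.comp H.subtype)) =
      (LinearMap.restrict A (mapsTo_invariants hA H)).charpoly.rootMultiplicity μ := by
  have key : (Representation.invariants
      ((maxGenEigenspaceSubrep hA μ).toRepresentation.comp H.subtype)).map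
        (maxGenEigenspaceSubrep hA μ).toSubmodule.subtype =
      ((A.genEigenspace μ ⊤).comap (Representation.invariants (ρ.comp H.subtype)).subtype).map
        (Representation.invariants (ρ.comp H.subtype)).subtype := by
    ext v
    simp only [Submodule.mem_map, Submodule.mem_comap, Submodule.subtype_apply, Subtype.exists,
      exists_and_right, exists_eq_right]
    constructor
    · rintro ⟨hv, h⟩
      exact ⟨fun g ↦ congrArg Subtype.val (h g), hv⟩
    · rintro ⟨h, hv⟩
      exact ⟨hv, fun g ↦ Subtype.ext (h g)⟩
  rw [← LinearMap.finrank_maxGenEigenspace_eq, Module.End.maxGenEigenspace,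
    Module.End.genEigenspace_restrict, ← Submodule.finrank_map_subtype_eq, key,
    Submodule.finrank_map_subtype_eq]

/-- The determinants of an equivariant automorphism on the invariants of subgroups are the
exponentials of the means of a class function. -/
lemma isMeanExp_det_restrict_invariants [Fintype G] {ρ : Representation ℂ G V}
    {A : Module.End ℂ V} (hA : ∀ g, Commute A (ρ g)) (hdet : LinearMap.det A ≠ 0) :
    IsMeanExp fun H ↦ LinearMap.det (A.restrict (mapsTo_invariants hA H)) := by
  classical
  let s := A.charpoly.roots.toFinset
  have hs : ∀ μ ∈ s, μ ≠ 0 := by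
    rintro μ hμ rfl
    rw [Multiset.mem_toFinset, Polynomial.mem_roots', ← Module.End.hasEigenvalue_iff_isRoot_charpoly,
      Module.End.hasEigenvalue_iff, Module.End.eigenspace_zero] at hμ
    exact hμ.2 (LinearMap.ker_eq_bot.mpr
      (LinearEquiv.ofIsUnitDet (f := A) (v := Module.finBasis ℂ V) (v' := Module.finBasis ℂ V)
        (by rwa [isUnit_iff_ne_zero, LinearMap.det_toMatrix])).injective)
  refine ⟨∑ μ ∈ s, Complex.log μ • (maxGenEigenspaceSubrep hA μ).toRepresentation.character,
    fun g h ↦ ?_, fun H ↦ ?_⟩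
  · simp only [Finset.sum_apply, Pi.smul_apply]
    exact Finset.sum_congr rfl fun μ _ ↦ by rw [isClassFunction_character _ g h]
  · set B := A.restrict (mapsTo_invariants hA H) with hB
    -- Eigenvalues on `V^H` are eigenvalues on `V`; those that do not occur on `V^H` contribute
    -- exponent 0, so one index set serves for all `H`.
    have hsub : B.charpoly.roots.toFinset ⊆ s := by
      intro μ hμ
      rw [Multiset.mem_toFinset, Polynomial.mem_roots (LinearMap.charpoly_monic _).ne_zero,
        ← Module.End.hasEigenvalue_iff_isRoot_charpoly] at hμ ⊢
      obtain ⟨⟨v, hv⟩, hv1, hv2⟩ := hμ.exists_hasEigenvector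
      refine Module.End.hasEigenvalue_of_hasEigenvector (x := v) ⟨?_, fun h ↦ hv2 ?_⟩
      · rw [Module.End.mem_genEigenspace_one] at hv1 ⊢
        exact congrArg Subtype.val hv1
      · exact Subtype.ext h
    have := Module.End.det_eq_prod_roots_charpoly_of_splits (f := B) (IsAlgClosed.splits _)
    change LinearMap.det B = _
    rw [this, Finset.prod_multiset_count_of_subset _ _ hsub, subgroupMean_sum, Complex.exp_sum]
    refine Finset.prod_congr rfl fun μ hμ ↦ ?_
    rw [subgroupMean_smul, subgroupMean_character, finrank_invariants_maxGenEigenspaceSubrep,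
      mul_comm, Complex.exp_nat_mul, Complex.exp_log (hs μ hμ), Polynomial.count_roots]

end Determinants

/-! ### Gram determinants and sublattices of finite index -/

section Lattices

variable {M N : Type*} [AddCommGroup M] [AddCommGroup N]

lemma det_gram_eq_sq_mul {κ : Type*} [Fintype κ] [DecidableEq κ]
    (B : M →ₗ[ℤ] M →ₗ[ℤ] ℂ) (b : Module.Basis κ ℤ M) (v : κ → M) :
    (Matrix.of fun i j ↦ B (v i) (v j)).det =
      (b.det v : ℂ) ^ 2 * (Matrix.of fun i j ↦ B (b i) (b j)).det := by
  have : (Matrix.of fun i j ↦ B (v i) (v j)) =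
      ((b.toMatrix v).map (Int.castRingHom ℂ)).transpose * (Matrix.of fun i j ↦ B (b i) (b j)) *
        (b.toMatrix v).map (Int.castRingHom ℂ) := by
    ext i j
    conv_lhs => rw [Matrix.of_apply, ← b.sum_toMatrix_smul_self v i, ← b.sum_toMatrix_smul_self v j]
    simp only [map_sum, LinearMap.sum_apply, map_smul, LinearMap.smul_apply, Matrix.mul_apply,
      Matrix.transpose_apply, Matrix.map_apply, Matrix.of_apply, Finset.sum_mul, zsmul_eq_mul,
      Int.coe_castRingHom]
    refine Finset.sum_congr rfl fun k _ ↦ ?_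
    rw [Finset.mul_sum]
    exact Finset.sum_congr rfl fun l _ ↦ by ring
  rw [this, Matrix.det_mul, Matrix.det_mul, Matrix.det_transpose, ← RingHom.mapMatrix_apply,
    ← RingHom.map_det, ← Module.Basis.det_apply]
  simp only [Int.coe_castRingHom]
  ring

lemma det_gram_eq_of_basis {κ κ' : Type*} [Fintype κ] [DecidableEq κ] [Fintype κ'] [DecidableEq κ']
    (B : M →ₗ[ℤ] M →ₗ[ℤ] ℂ) (b : Module.Basis κ ℤ M) (b' : Module.Basis κ' ℤ M) :
    (Matrix.of fun i j ↦ B (b' i) (b' j)).det = (Matrix.of fun i j ↦ B (b i) (b j)).det := by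
  let e := b'.indexEquiv b
  have h1 : (Matrix.of fun i j ↦ B (b' i) (b' j)).det =
      (Matrix.of fun i j ↦ B (b'.reindex e i) (b'.reindex e j)).det := by
    rw [← Matrix.det_submatrix_equiv_self e.symm]
    congr 1
    ext i j
    simp
  have h2 : (b.det (b'.reindex e) : ℂ) ^ 2 = 1 := by
    rcases Int.isUnit_iff.mp (b.isUnit_det (b'.reindex e)) with h | h <;> rw [h] <;> norm_num
  rw [h1, det_gram_eq_sq_mul B b, h2, one_mul]

variable [Module.Free ℤ M] [Module.Finite ℤ M]

/-- For a torsion-free lattice, `pairingDet` is the determinant of the Gram matrix of any basis. -/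
lemma pairingDet_eq_det {κ : Type*} [Fintype κ] [DecidableEq κ]
    (B : M →ₗ[ℤ] M →ₗ[ℤ] ℂ) (W : Submodule ℤ M) (b : Module.Basis κ ℤ W) :
    pairingDet B W = (Matrix.of fun i j ↦ B (b i) (b j)).det := by
  classical
  have htors : Submodule.torsion ℤ W = ⊥ := Submodule.isTorsionFree_iff_torsion_eq_bot.mp inferInstance
  let e : W ≃ₗ[ℤ] (W ⧸ Submodule.torsion ℤ W) :=
    LinearEquiv.ofBijective (Submodule.mkQ _)
      ⟨by rw [← LinearMap.ker_eq_bot, Submodule.ker_mkQ, htors], Submodule.mkQ_surjective _⟩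
  have hlift : ∀ x, Function.surjInv (Submodule.mkQ_surjective (Submodule.torsion ℤ W)) x =
      e.symm x := by
    intro x
    apply e.injective
    rw [e.apply_symm_apply]
    exact Function.surjInv_eq _ x
  let b₀ := (Module.Free.chooseBasis ℤ (W ⧸ Submodule.torsion ℤ W)).map e.symm
  have := det_gram_eq_of_basis (B.compl₁₂ W.subtype W.subtype) b b₀
  simp only [LinearMap.compl₁₂_apply, Submodule.subtype_apply] at this
  rw [← this, pairingDet]
  simp only [hlift, b₀, Module.Basis.map_apply]

variable [Module.Free ℤ N] [Module.Finite ℤ N]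

omit [Module.Free ℤ M] in
-- Multiplication by the order of the cokernel moves `W` into the range of `i`, which embeds `W`
-- into its preimage; `i` gives the reverse inequality.
lemma finrank_comap_eq {i : M →ₗ[ℤ] N} (hi : Function.Injective i)
    (hfin : Finite (N ⧸ LinearMap.range i)) (W : Submodule ℤ N) :
    Module.finrank ℤ (W.comap i) = Module.finrank ℤ W := by
  apply le_antisymm
  · refine LinearMap.finrank_le_finrank_of_injective
      (f := (i.restrict (p := W.comap i) (q := W) fun x hx ↦ hx)) fun x y h ↦ ?_
    exact Subtype.ext (hi (congrArg Subtype.val h))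
  · have hn : ∀ x : N, Nat.card (N ⧸ LinearMap.range i) • x ∈ LinearMap.range i := fun x ↦
      AddSubgroup.nsmul_index_mem (LinearMap.range i).toAddSubgroup x
    let e := LinearEquiv.ofInjective i hi
    let f : W →ₗ[ℤ] LinearMap.range i :=
      ((Nat.card (N ⧸ LinearMap.range i) • LinearMap.id : N →ₗ[ℤ] N).comp W.subtype).codRestrict _
        fun x ↦ by simpa using hn x
    have hf : ∀ x, i (e.symm (f x)) = Nat.card (N ⧸ LinearMap.range i) • (x : N) := by
      intro x
      have : i (e.symm (f x)) = (f x : N) := by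
        conv_rhs => rw [← e.apply_symm_apply (f x)]
        rfl
      rw [this]
      rfl
    refine LinearMap.finrank_le_finrank_of_injective
      (f := (e.symm.toLinearMap.comp f).codRestrict (W.comap i) fun x ↦ ?_) fun x y h ↦ ?_
    · rw [Submodule.mem_comap]
      change i (e.symm (f x)) ∈ W
      rw [hf]
      exact W.nsmul_mem x.2 _
    · have h' : e.symm (f x) = e.symm (f y) := congrArg Subtype.val h
      have := congrArg i h'
      rw [hf, hf] at this
      rw [← Nat.cast_smul_eq_nsmul ℤ, ← Nat.cast_smul_eq_nsmul ℤ] at this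
      exact Subtype.ext (smul_right_injective N (Nat.cast_ne_zero.mpr Nat.card_pos.ne') this)

/-- The effect of passing to a sublattice of finite index on the determinant of a pairing. -/
lemma pairingDet_compl₁₂ (B : N →ₗ[ℤ] N →ₗ[ℤ] ℂ) {i : M →ₗ[ℤ] N} (hi : Function.Injective i)
    (hfin : Finite (N ⧸ LinearMap.range i)) (W : Submodule ℤ N) :
    pairingDet (B.compl₁₂ i i) (W.comap i) =
      (((W.comap i).map i).toAddSubgroup.relIndex W.toAddSubgroup : ℂ) ^ 2 * pairingDet B W := by
  classical
  let b := Module.finBasis ℤ W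
  let b' := (Module.finBasis ℤ (W.comap i)).reindex (finCongr (finrank_comap_eq hi hfin W))
  rw [pairingDet_eq_det _ _ b', pairingDet_eq_det _ _ b]
  have h := det_gram_eq_sq_mul (B.compl₁₂ W.subtype W.subtype) b fun k ↦ ⟨i (b' k), (b' k).2⟩
  simp only [LinearMap.compl₁₂_apply, Submodule.subtype_apply] at h ⊢
  rw [h]
  congr 1
  have hle : ((W.comap i).map i).toAddSubgroup ≤ W.toAddSubgroup := by
    rw [Submodule.toAddSubgroup_le]
    exact Submodule.map_comap_le i W
  -- The index is the absolute value of the base-change determinant, and the square removes the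
  -- sign.
  have := AddSubgroup.relIndex_eq_natAbs_det _ _ hle
    (b'.map (Submodule.equivMapOfInjective i hi (W.comap i))) b
  rw [this, ← Int.cast_natCast, ← Int.cast_pow, ← Int.cast_pow, Int.natAbs_sq]
  rfl

omit [Module.Free ℤ M] [Module.Finite ℤ M] [Module.Free ℤ N] [Module.Finite ℤ N] in
lemma relIndex_map_comap_ne_zero {i : M →ₗ[ℤ] N} (hfin : Finite (N ⧸ LinearMap.range i))
    (W : Submodule ℤ N) :
    ((W.comap i).map i).toAddSubgroup.relIndex W.toAddSubgroup ≠ 0 := by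
  have h1 : ((W.comap i).map i).toAddSubgroup =
      (LinearMap.range i).toAddSubgroup ⊓ W.toAddSubgroup := by
    rw [Submodule.map_comap_eq]
    rfl
  rw [h1, AddSubgroup.inf_relIndex_right]
  have : (LinearMap.range i).toAddSubgroup.FiniteIndex :=
    AddSubgroup.finiteIndex_iff_finite_quotient.mpr hfin
  exact AddSubgroup.FiniteIndex.index_ne_zero

end Lattices

/-! ### Comparison of two invariant pairings -/

section PairingChange

variable {G M : Type*} [Group G] [AddCommGroup M]

/-- The complexification of a representation on an abelian group. -/
def complexRep (ρ : Representation ℤ G M) : Representation ℂ G (ℂ ⊗[ℤ] M) where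
  toFun g := (ρ g).baseChange ℂ
  map_one' := by rw [map_one]; exact LinearMap.baseChange_id
  map_mul' g h := by rw [map_mul]; exact LinearMap.baseChange_comp _ _

@[simp]
lemma complexRep_tmul (ρ : Representation ℤ G M) (g : G) (c : ℂ) (m : M) :
    complexRep ρ g (c ⊗ₜ m) = c ⊗ₜ ρ g m :=
  LinearMap.baseChange_tmul _ _ _

/-- The `ℂ`-bilinear extension of a `ℂ`-valued pairing. -/
def complexPairing (B : M →ₗ[ℤ] M →ₗ[ℤ] ℂ) : (ℂ ⊗[ℤ] M) →ₗ[ℂ] Module.Dual ℂ (ℂ ⊗[ℤ] M) :=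
  LinearMap.liftBaseChange ℂ
    (((LinearMap.liftBaseChangeEquiv ℂ).restrictScalars ℤ).toLinearMap ∘ₗ B)

@[simp]
lemma complexPairing_tmul (B : M →ₗ[ℤ] M →ₗ[ℤ] ℂ) (c d : ℂ) (x y : M) :
    complexPairing B (c ⊗ₜ x) (d ⊗ₜ y) = c * d * B x y := by
  simp [complexPairing, mul_assoc]

lemma complexPairing_ext {f f' : (ℂ ⊗[ℤ] M) →ₗ[ℂ] Module.Dual ℂ (ℂ ⊗[ℤ] M)}
    (h : ∀ x y : M, f (1 ⊗ₜ x) (1 ⊗ₜ y) = f' (1 ⊗ₜ x) (1 ⊗ₜ y)) : f = f' := by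
  ext x y
  simpa using h x y

lemma complexPairing_invariant {ρ : Representation ℤ G M} {B : M →ₗ[ℤ] M →ₗ[ℤ] ℂ}
    (hB : IsInvariantPairing ρ B) (g : G) (v w : ℂ ⊗[ℤ] M) :
    complexPairing B (complexRep ρ g v) (complexRep ρ g w) = complexPairing B v w := by
  have : (complexPairing B).compl₁₂ (complexRep ρ g) (complexRep ρ g) = complexPairing B :=
    complexPairing_ext fun x y ↦ by simp [hB g x y]
  exact LinearMap.congr_fun₂ this v w

variable [Module.Free ℤ M] [Module.Finite ℤ M]

lemma complexPairing_bijective {B : M →ₗ[ℤ] M →ₗ[ℤ] ℂ} (hB : NondegeneratePairing B) :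
    Function.Bijective (complexPairing B) := by
  classical
  let e := Module.finBasis ℤ M
  let b := Algebra.TensorProduct.basis ℂ e
  have hdet : (LinearMap.toMatrix b b.dualBasis (complexPairing B)).det ≠ 0 := by
    rw [NondegeneratePairing, pairingDet_eq_det B ⊤ (e.map Submodule.topEquiv.symm)] at hB
    rw [← Matrix.det_transpose]
    convert! hB using 2
    ext i j
    rw [Matrix.transpose_apply, LinearMap.toMatrix_apply, Module.Basis.dualBasis_repr]
    simp [b]
  exact (LinearEquiv.ofIsUnitDet (f := complexPairing B) (v := b) (v' := b.dualBasis)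
    hdet.isUnit).bijective

omit [Module.Free ℤ M] [Module.Finite ℤ M] in
/-- A basis of `M^H` gives a basis of `(ℂ ⊗ M)^H`. -/
lemma exists_basis_invariants_complexRep [Finite G] (ρ : Representation ℤ G M) (H : Subgroup G)
    {κ : Type*} (b : Module.Basis κ ℤ (fixedBy ρ H)) :
    ∃ b' : Module.Basis κ ℂ (Representation.invariants ((complexRep ρ).comp H.subtype)),
      ∀ k, (b' k : ℂ ⊗[ℤ] M) = 1 ⊗ₜ (b k : M) := by
  classical
  have := Fintype.ofFinite H
  let f : (ℂ ⊗[ℤ] fixedBy ρ H) →ₗ[ℂ] ℂ ⊗[ℤ] M := (fixedBy ρ H).subtype.baseChange ℂ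
  have hinj : Function.Injective f :=
    Module.Flat.lTensor_preserves_injective_linearMap _ (fixedBy ρ H).injective_subtype
  have hmem : ∀ w, f w ∈ Representation.invariants ((complexRep ρ).comp H.subtype) := by
    intro w h
    induction w with
    | zero => simp
    | add x y hx hy => rw [map_add, map_add, hx, hy]
    | tmul c m =>
      change complexRep ρ h (c ⊗ₜ (m : M)) = c ⊗ₜ (m : M)
      rw [complexRep_tmul]
      congr 1
      exact m.2 h
  -- Sums over `H` lie in the image of `ℂ ⊗ M^H`; on an invariant vector the sum is multiplication
  -- by `|H|`, which is invertible in `ℂ`.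
  have havg : ∀ v : ℂ ⊗[ℤ] M, ∑ h : H, complexRep ρ h v ∈ LinearMap.range f := by
    intro v
    induction v with
    | zero => simp
    | add x y hx hy =>
      simp only [map_add, Finset.sum_add_distrib]
      exact Submodule.add_mem _ hx hy
    | tmul c m =>
      refine ⟨c ⊗ₜ ⟨∑ h : H, ρ h m, fun k ↦ ?_⟩, ?_⟩
      · rw [map_sum]
        exact Fintype.sum_equiv (Equiv.mulLeft k) _ _ fun h ↦ by
          simp [← Module.End.mul_apply, ← map_mul]
      · simp [f, TensorProduct.tmul_sum]
  let F : (ℂ ⊗[ℤ] fixedBy ρ H) ≃ₗ[ℂ]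
      Representation.invariants ((complexRep ρ).comp H.subtype) :=
    LinearEquiv.ofBijective (f.codRestrict _ hmem) (by
      refine ⟨fun x y h ↦ hinj (congrArg Subtype.val h), fun ⟨v, hv⟩ ↦ ?_⟩
      obtain ⟨w, hw⟩ := havg v
      have : ∑ h : H, complexRep ρ h v = (Nat.card H : ℂ) • v := by
        have hv' : ∀ h : H, complexRep ρ h v = v := hv
        rw [Finset.sum_congr rfl fun h _ ↦ hv' h, Finset.sum_const, Finset.card_univ,
          Nat.card_eq_fintype_card, Nat.cast_smul_eq_nsmul]
      refine ⟨(Nat.card H : ℂ)⁻¹ • w, Subtype.ext ?_⟩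
      have hc : (Nat.card H : ℂ) ≠ 0 := by exact_mod_cast Nat.card_pos.ne'
      change f _ = v
      rw [map_smul, hw, this, smul_smul, inv_mul_cancel₀ hc, one_smul])
  refine ⟨(Algebra.TensorProduct.basis ℂ b).map F, fun k ↦ ?_⟩
  rw [Module.Basis.map_apply, Algebra.TensorProduct.basis_apply]
  rfl

/-- Two invariant non-degenerate pairings have the same regulator determinants up to the
exponentials of the means of a class function. -/
theorem exists_isMeanExp_fixedDet [Fintype G] {ρ : Representation ℤ G M}
    {B₁ B₂ : M →ₗ[ℤ] M →ₗ[ℤ] ℂ} (h₁ : IsInvariantPairing ρ B₁) (h₂ : IsInvariantPairing ρ B₂)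
    (hn₁ : NondegeneratePairing B₁) (hn₂ : NondegeneratePairing B₂) :
    ∃ d : Subgroup G → ℂ, IsMeanExp d ∧ ∀ H, fixedDet ρ B₂ H = d H * fixedDet ρ B₁ H := by
  classical
  let E₁ := LinearEquiv.ofBijective _ (complexPairing_bijective hn₁)
  let E₂ := LinearEquiv.ofBijective _ (complexPairing_bijective hn₂)
  -- `A` is determined by `B₁(Av, w) = B₂(v, w)`. Invariance of both pairings makes it commute with
  -- `G`, and on `M^H` the Gram matrix of `B₂` is `Aᵀ` times that of `B₁`.
  let A : Module.End ℂ (ℂ ⊗[ℤ] M) := (E₂.trans E₁.symm).toLinearMap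
  have hA : ∀ v w, complexPairing B₁ (A v) w = complexPairing B₂ v w := by
    intro v w
    exact LinearMap.congr_fun (E₁.apply_symm_apply (E₂ v)) w
  have hcomm : ∀ g, Commute A (complexRep ρ g) := by
    intro g
    refine LinearMap.ext fun v ↦ E₁.injective (LinearMap.ext fun w ↦ ?_)
    have hw : complexRep ρ g (complexRep ρ g⁻¹ w) = w := by
      rw [← Module.End.mul_apply, ← map_mul]; simp
    change complexPairing B₁ (A (complexRep ρ g v)) w = complexPairing B₁ (complexRep ρ g (A v)) w
    rw [hA, ← hw, complexPairing_invariant h₁, complexPairing_invariant h₂, hA]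
  have hdet : LinearMap.det A ≠ 0 := (LinearEquiv.isUnit_det' (E₂.trans E₁.symm)).ne_zero
  refine ⟨_, isMeanExp_det_restrict_invariants hcomm hdet, fun H ↦ ?_⟩
  let b := Module.finBasis ℤ (fixedBy ρ H)
  obtain ⟨b', hb'⟩ := exists_basis_invariants_complexRep ρ H b
  set AH := A.restrict (mapsTo_invariants hcomm H) with hAH
  rw [fixedDet, fixedDet, pairingDet_eq_det _ _ b, pairingDet_eq_det _ _ b,
    ← LinearMap.det_toMatrix b', ← Matrix.det_transpose (LinearMap.toMatrix b' b' AH), ← Matrix.det_mul]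
  congr 1
  ext i j
  have h1 : A (1 ⊗ₜ (b i : M)) = ∑ k, LinearMap.toMatrix b' b' AH k i • (1 ⊗ₜ (b k : M)) := by
    have := congrArg Subtype.val (b'.sum_repr (AH (b' i)))
    simp only [hAH, AddSubmonoidClass.coe_finsetSum, Submodule.coe_smul, hb',
      LinearMap.coe_restrict_apply] at this
    rw [← this]
    simp only [LinearMap.toMatrix_apply, hAH]
  have h2 := hA (1 ⊗ₜ (b i : M)) (1 ⊗ₜ (b j : M))
  rw [h1] at h2
  simp only [map_sum, LinearMap.sum_apply, map_smul, LinearMap.smul_apply, complexPairing_tmul,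
    one_mul, smul_eq_mul] at h2
  simp only [Matrix.mul_apply, Matrix.transpose_apply, Matrix.of_apply, LinearMap.smul_apply,
    smul_eq_mul, ← h2, Finset.mul_sum]
  exact Finset.sum_congr rfl fun k _ ↦ by ring

end PairingChange

/-! ### Locally monogenic generators -/

section Monogenic

variable {A B : Type*} [CommRing A] [CommRing B] [IsDedekindDomain B] [Algebra A B]
  [Module.Finite A B]

open Polynomial in
/-- If `x` generates the residue field extension at `P`, lies in all other primes over
`P ∩ A`, and some polynomial in `x` is a uniformiser at `P`, then the conductor of `A[x]` is prime
to `P`. -/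
lemma not_conductor_le_of_generates {P : Ideal B} [hP : P.IsPrime] (hP0 : P ≠ ⊥) (x : B)
    (hres : ∀ y : B, ∃ f : A[X], y - aeval x f ∈ P)
    (huni : ∃ f : A[X], aeval x f ∈ P ∧ aeval x f ∉ P ^ 2)
    (hx : ∀ Q : Ideal B, Q.IsPrime → Q.under A = P.under A → Q ≠ P → x ∈ Q) (hxP : x ∉ P) :
    ¬ conductor A x ≤ P := by
  let B' := Algebra.adjoin A {x}
  have hmem : ∀ f : A[X], aeval x f ∈ B' := fun f ↦ aeval_mem_adjoin_singleton A x
  let q : Ideal B' := P.comap (algebraMap B' B)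
  have : Module.Finite B' B := Module.Finite.of_restrictScalars_finite A B' B
  have hmax : P.IsMaximal := hP.isMaximal hP0
  have : Algebra.IsIntegral B' B := inferInstance
  have hqmax : q.IsMaximal := Ideal.isMaximal_comap_of_isIntegral_of_isMaximal (R := B') P
  -- Write `qB = PJ`. A maximal ideal `Q ⊇ J` equal to `P` would put the uniformiser in `P²`; any
  -- other `Q` contracts to `q`, contains `x`, and so forces `x ∈ P`.
  have hqB : q.map (algebraMap B' B) = P := by
    have hle : q.map (algebraMap B' B) ≤ P := Ideal.map_comap_le
    obtain ⟨f, hf1, hf2⟩ := huni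
    have hfq : aeval x f ∈ q.map (algebraMap B' B) :=
      Ideal.mem_map_of_mem (algebraMap B' B) (x := ⟨aeval x f, hmem f⟩) hf1
    have hne : q.map (algebraMap B' B) ≠ ⊥ := by
      intro h
      rw [h, Ideal.mem_bot] at hfq
      exact hf2 (hfq ▸ zero_mem _)
    obtain ⟨J, hJ⟩ := Ideal.dvd_iff_le.mpr hle
    have hJtop : J = ⊤ := by
      by_contra hJ1
      obtain ⟨Q, hQ, hJQ⟩ := Ideal.exists_le_maximal J hJ1
      have hmQ : q.map (algebraMap B' B) ≤ Q := (hJ.le.trans Ideal.mul_le_right).trans hJQ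
      have hqQ : q = Q.comap (algebraMap B' B) :=
        hqmax.eq_of_le (Ideal.comap_ne_top _ hQ.ne_top) (Ideal.map_le_iff_le_comap.mp hmQ)
      by_cases hQP : Q = P
      · subst hQP
        refine hf2 ?_
        have : q.map (algebraMap B' B) ≤ Q ^ 2 := by
          rw [hJ, pow_two]
          exact Ideal.mul_mono_right hJQ
        exact this hfq
      · refine hxP ?_
        have h1 : x ∈ Q := hx Q hQ.isPrime ?_ hQP
        · have : (⟨x, Algebra.self_mem_adjoin_singleton A x⟩ : B') ∈ Q.comap (algebraMap B' B) := h1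
          rw [← hqQ] at this
          exact this
        · have h2 := congrArg (Ideal.comap (algebraMap A B')) hqQ
          rw [Ideal.comap_comap, Ideal.comap_comap, ← IsScalarTower.algebraMap_eq] at h2
          exact h2.symm
    rw [hJ, hJtop, Ideal.mul_top]
  let R : Submodule B' B := LinearMap.range (Algebra.linearMap B' B)
  -- Since `B = A[x] + P` and `P = qB`, Nakayama's lemma for `B / A[x]` yields `r ≡ 1` mod `q`
  -- killing this quotient, that is, `r` in the conductor but outside `P`.
  have hNak : (⊤ : Submodule B' (B ⧸ R)) ≤ q • ⊤ := by
    rintro y -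
    obtain ⟨y, rfl⟩ := Submodule.mkQ_surjective R y
    obtain ⟨f, hf⟩ := hres y
    have h0 : R.mkQ (aeval x f) = 0 := by
      rw [Submodule.mkQ_apply, Submodule.Quotient.mk_eq_zero]
      exact ⟨⟨aeval x f, hmem f⟩, rfl⟩
    have h1 : R.mkQ y = R.mkQ (y - aeval x f) := by rw [map_sub, h0, sub_zero]
    have h2 : y - aeval x f ∈ q • (⊤ : Submodule B' B) := by
      rw [Ideal.smul_top_eq_map, hqB]
      exact hf
    rw [h1, ← Submodule.range_mkQ R, ← Submodule.map_top, ← Submodule.map_smul'']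
    exact Submodule.mem_map_of_mem h2
  obtain ⟨r, hr1, hr2⟩ := Submodule.exists_sub_one_mem_and_smul_eq_zero_of_fg_of_le_smul q _
    Module.Finite.fg_top hNak
  intro hle
  have hrc : (r : B) ∈ conductor A x := by
    intro b
    have := hr2 (R.mkQ b) trivial
    rw [← map_smul, Submodule.mkQ_apply, Submodule.Quotient.mk_eq_zero] at this
    obtain ⟨c, hc⟩ := this
    have hc' : (c : B) = r * b := hc
    rw [← hc']
    exact c.2
  refine hqmax.ne_top ((Ideal.eq_top_iff_one q).mpr ?_)
  have : (r : B') ∈ q := hle hrc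
  simpa using sub_mem this hr1

open Polynomial in
/-- For every prime `P` with finite residue field there is an element generating a subring whose
conductor is prime to `P`. -/
lemma exists_not_conductor_le [IsDedekindDomain A] [Module.IsTorsionFree A B]
    {P : Ideal B} [hP : P.IsPrime] (hP0 : P ≠ ⊥)
    (hfin : Finite (B ⧸ P)) : ∃ x : B, ¬ conductor A x ≤ P := by
  classical
  have hmax : P.IsMaximal := hP.isMaximal hP0
  have : (P.under A).IsMaximal := Ideal.isMaximal_comap_of_isIntegral_of_isMaximal P
  let _ : Field (B ⧸ P) := Ideal.Quotient.field P
  let S := (IsDedekindDomain.primesOver_finite (P.under A) B).toFinset.erase P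
  have hcop : IsCoprime (P ^ 2) (∏ Q ∈ S, Q) := by
    refine IsCoprime.pow_left (IsCoprime.prod_right fun Q hQ ↦ ?_)
    rw [Finset.mem_erase, Set.Finite.mem_toFinset] at hQ
    have := hQ.2.1
    have := hQ.2.2
    have : Q.IsMaximal := Ideal.IsMaximal.of_liesOver_isMaximal Q (P.under A)
    exact Ideal.isCoprime_of_isMaximal (Ne.symm hQ.1)
  obtain ⟨u, hu, v, hv, huv⟩ := Ideal.isCoprime_iff_exists.mp hcop
  have := Fintype.ofFinite (B ⧸ P)
  set n := Fintype.card (B ⧸ P) with hn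
  have hnP : (n : B) ∈ P := by
    rw [← Ideal.Quotient.eq_zero_iff_mem, map_natCast]
    exact Nat.cast_card_eq_zero _
  obtain ⟨ζ, hζ⟩ := IsCyclic.exists_generator (α := (B ⧸ P)ˣ)
  obtain ⟨a, ha⟩ := Ideal.Quotient.mk_surjective (ζ : B ⧸ P)
  have hfrob : ∀ b : B, b ^ n - b ∈ P := by
    intro b
    rw [← Ideal.Quotient.eq_zero_iff_mem, map_sub, map_pow, hn, FiniteField.pow_card, sub_self]
  -- If `a ^ n - a` is not a uniformiser at `P`, shifting `a` by `π ∈ P \ P²` changes it by `-π` mod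
  -- `P²`, because `n ∈ P`.
  obtain ⟨c, hca, hc⟩ : ∃ c, c - a ∈ P ∧ c ^ n - c ∉ P ^ 2 := by
    by_cases h : a ^ n - a ∈ P ^ 2
    · obtain ⟨π, hπ, hπ2⟩ : ∃ π ∈ P, π ∉ P ^ 2 := by
        by_contra! hcon
        have := Ideal.pow_right_strictAnti P hP0 hmax.ne_top (show 1 < 2 by norm_num)
        exact this.not_ge (by simpa only [pow_one] using! hcon)
      refine ⟨a + π, by simpa using hπ, fun h2 ↦ hπ2 ?_⟩
      obtain ⟨k, hk⟩ := Polynomial.binomExpansion (X ^ n : B[X]) a π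
      simp only [eval_pow, eval_X, derivative_X_pow, eval_mul, eval_natCast,
        map_natCast] at hk
      have h3 : π = (a ^ n - a) + (n * π) * a ^ (n - 1) + k * π ^ 2 - ((a + π) ^ n - (a + π)) := by
        rw [hk]; ring
      rw [h3]
      refine sub_mem (add_mem (add_mem h ?_) ?_) h2
      · refine Ideal.mul_mem_right _ _ ?_
        rw [pow_two]
        exact Ideal.mul_mem_mul hnP hπ
      · exact Ideal.mul_mem_left _ _ (Ideal.pow_mem_pow hπ 2)
    · exact ⟨a, by simp, h⟩
  have hu2 : u ∈ P := Ideal.pow_le_self two_ne_zero hu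
  have hxc : c * v - c ∈ P ^ 2 := by
    have : c * v - c = (-c) * u := by linear_combination c * huv
    rw [this]
    exact Ideal.mul_mem_left _ _ hu
  have hmk : Ideal.Quotient.mk P (c * v) = ζ := by
    rw [← ha]
    refine Ideal.Quotient.eq.mpr ?_
    have : c * v - a = (c * v - c) + (c - a) := by ring
    rw [this]
    exact add_mem (Ideal.pow_le_self two_ne_zero hxc) hca
  -- As `v ≡ 1` mod `P²` and `v` lies in the other primes over `P ∩ A`, so does `c * v`, while it
  -- agrees with `c` mod `P²`. Residues are 0 or powers of `ζ`, and `X ^ n - X` supplies the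
  -- uniformiser.
  refine ⟨c * v, not_conductor_le_of_generates hP0 (c * v) ?_ ⟨X ^ n - X, ?_, ?_⟩ ?_ ?_⟩
  · intro y
    by_cases hy : Ideal.Quotient.mk P y = 0
    · exact ⟨0, by simpa using Ideal.Quotient.eq_zero_iff_mem.mp hy⟩
    · obtain ⟨m, hm⟩ := (Submonoid.mem_powers_iff _ _).mp
        ((mem_powers_iff_mem_zpowers).mpr (hζ (Units.mk0 _ hy)))
      refine ⟨X ^ m, ?_⟩
      rw [← Ideal.Quotient.eq_zero_iff_mem, map_sub, map_pow, aeval_X, map_pow, hmk,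
        ← Units.val_pow_eq_pow_val, hm, Units.val_mk0, sub_self]
  · simpa using hfrob (c * v)
  · intro h
    refine hc ?_
    have h1 : (c * v) ^ n - c ^ n ∈ P ^ 2 :=
      Ideal.mem_of_dvd _ (sub_dvd_pow_sub_pow _ _ _) hxc
    simp only [map_sub, map_pow, aeval_X] at h
    have : c ^ n - c = ((c * v) ^ n - c * v) - ((c * v) ^ n - c ^ n) + (c * v - c) := by ring
    rw [this]
    exact add_mem (sub_mem h h1) hxc
  · intro Q hQ hQP hne
    refine Ideal.mul_mem_left _ _ ?_
    have hQS : Q ∈ S := by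
      rw [Finset.mem_erase, Set.Finite.mem_toFinset]
      exact ⟨hne, hQ, ⟨hQP.symm⟩⟩
    exact Ideal.le_of_dvd (Finset.dvd_prod_of_mem _ hQS) hv
  · intro h
    rw [← Ideal.Quotient.eq_zero_iff_mem, hmk] at h
    exact ζ.ne_zero h

end Monogenic

/-! ### Hilbert's formula for the different -/

section Different

open NumberField

/-- The ideal generated by the differences `σ x - x`. -/
def displacementIdeal {R : Type*} [CommRing R] (σ : R → R) : Ideal R :=
  Ideal.span (Set.range fun x ↦ σ x - x)

/-- The colon ideal `(I : J)` lies in no maximal ideal, hence contains 1. This checks an inclusion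
one prime at a time without localising. -/
lemma ideal_le_of_forall_exists_mul_mem {R : Type*} [CommRing R] {I J : Ideal R}
    (h : ∀ P : Ideal R, P.IsMaximal → ∃ c ∉ P, ∀ y ∈ J, c * y ∈ I) : J ≤ I := by
  have key : Submodule.colon I (J : Set R) = ⊤ := by
    by_contra hne
    obtain ⟨P, hP, hle⟩ := Ideal.exists_le_maximal _ hne
    obtain ⟨c, hc, hcJ⟩ := h P hP
    exact hc (hle (Submodule.mem_colon.mpr fun y hy ↦ hcJ y hy))
  intro y hy
  have h1 : (1 : R) ∈ Submodule.colon I (J : Set R) := key ▸ Submodule.mem_top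
  simpa using Submodule.mem_colon.mp h1 y hy

variable {L K : Type*} [Field L] [NumberField L] [Field K] [NumberField K] [Algebra L K]

lemma adjoin_eq_top_of_mem_conductor {x c : 𝓞 K} (hc : c ∈ conductor (𝓞 L) x) (hc0 : c ≠ 0) :
    Algebra.adjoin L {(algebraMap (𝓞 K) K x)} = ⊤ := by
  set S := Algebra.adjoin L {(algebraMap (𝓞 K) K x)} with hS
  have hfield : IsField S :=
    Subalgebra.isField_of_algebraic S
  have hmem : ∀ y ∈ Algebra.adjoin (𝓞 L) {x}, algebraMap (𝓞 K) K y ∈ S := by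
    intro y hy
    induction hy using Algebra.adjoin_induction with
    | mem z hz =>
      rw [Set.mem_singleton_iff] at hz
      subst hz
      exact Algebra.self_mem_adjoin_singleton L _
    | algebraMap r =>
      rw [← IsScalarTower.algebraMap_apply, IsScalarTower.algebraMap_apply (𝓞 L) L K]
      exact S.algebraMap_mem _
    | add a b _ _ ha hb => rw [map_add]; exact add_mem ha hb
    | mul a b _ _ ha hb => rw [map_mul]; exact mul_mem ha hb
  have hdiv : ∀ a b : K, a ∈ S → b ∈ S → a / b ∈ S := by
    intro a b ha hb
    rw [div_eq_mul_inv]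
    by_cases hb0 : b = 0
    · simp [hb0]
    · obtain ⟨d, hd⟩ := hfield.mul_inv_cancel (a := ⟨b, hb⟩) (fun h ↦ hb0 (congrArg Subtype.val h))
      have : b⁻¹ = d := inv_eq_of_mul_eq_one_right (congrArg Subtype.val hd)
      rw [this]
      exact mul_mem ha d.2
  have hc0' : algebraMap (𝓞 K) K c ≠ 0 := by
    rwa [Ne, FaithfulSMul.algebraMap_eq_zero_iff]
  have hint : ∀ b : 𝓞 K, algebraMap (𝓞 K) K b ∈ S := by
    intro b
    have := hdiv _ _ (hmem _ (hc b)) (hmem _ (conductor_subset_adjoin hc))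
    rwa [map_mul, mul_div_cancel_left₀ _ hc0'] at this
  rw [eq_top_iff]
  rintro k -
  obtain ⟨a, b, -, rfl⟩ := IsFractionRing.div_surjective (A := 𝓞 K) k
  exact hdiv _ _ (hint a) (hint b)

variable [IsGalois L K]

open Polynomial in
-- A generator has distinct conjugates, so its minimal polynomial splits as `∏ (X - σx)`;
-- differentiating at `x` deletes the factor of `σ = 1`.
lemma aeval_derivative_minpoly_eq_prod [Fintype (K ≃ₐ[L] K)] [DecidableEq (K ≃ₐ[L] K)] {x : 𝓞 K}
    (hx : Algebra.adjoin L {(algebraMap (𝓞 K) K x)} = ⊤) :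
    aeval x (derivative (minpoly (𝓞 L) x)) =
      ∏ σ ∈ Finset.univ.erase (1 : K ≃ₐ[L] K), (x - σ • x) := by
  have hinj := FaithfulSMul.algebraMap_injective (𝓞 K) K
  set z := algebraMap (𝓞 K) K x with hz
  have hint : IsIntegral L z := Algebra.IsIntegral.isIntegral z
  have hdistinct : Function.Injective fun σ : K ≃ₐ[L] K ↦ σ z := by
    intro σ τ h
    have : (σ : K →ₐ[L] K) = τ := AlgHom.ext_of_adjoin_eq_top hx (by simpa using h)
    exact AlgEquiv.coe_toAlgHom_injective this
  have hmin : (minpoly L z).map (algebraMap L K) = ∏ σ : K ≃ₐ[L] K, (X - C (σ z)) := by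
    refine eq_of_monic_of_dvd_of_natDegree_le (monic_prod_of_monic _ _ fun σ _ ↦ monic_X_sub_C _)
      ((minpoly.monic hint).map _) ?_ ?_
    · refine Finset.prod_dvd_of_coprime (fun σ _ τ _ h ↦ ?_) fun σ _ ↦ ?_
      · exact pairwise_coprime_X_sub_C hdistinct h
      · rw [dvd_iff_isRoot, IsRoot, eval_map_algebraMap]
        have := minpoly.aeval L z
        rw [← AlgEquiv.coe_toAlgHom, aeval_algHom_apply, this, map_zero]
    · rw [natDegree_map, natDegree_prod_of_monic _ _ fun σ _ ↦ monic_X_sub_C _]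
      simp only [natDegree_X_sub_C, Finset.sum_const, Finset.card_univ, smul_eq_mul, mul_one]
      rw [← Nat.card_eq_fintype_card, IsGalois.card_aut_eq_finrank]
      exact minpoly.natDegree_le z
  apply hinj
  rw [← aeval_algebraMap_apply, ← hz, ← aeval_map_algebraMap L, ← derivative_map,
    ← minpoly.isIntegrallyClosed_eq_field_fractions L K (Algebra.IsIntegral.isIntegral x),
    ← eval_map_algebraMap, ← derivative_map, hmin, ← Finset.mul_prod_erase _ _ (Finset.mem_univ 1)]
  have heval : ∀ Q : K[X], eval z (derivative ((X - C z) * Q)) = eval z Q := fun Q ↦ by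
    simp [derivative_mul]
  rw [AlgEquiv.one_apply, heval, eval_prod, map_prod]
  refine Finset.prod_congr rfl fun σ _ ↦ ?_
  rw [eval_sub, eval_X, eval_C, map_sub]
  rfl

omit [NumberField L] [NumberField K] [IsGalois L K] in
-- On `𝓞 L[x]` each `σz - z` is a multiple of `x - σx`, by the twisted Leibniz rule. For general
-- `y`, both `c` and `cy` lie in `𝓞 L[x]`, and `c(σy - y) = (σ(cy) - cy) - (σc - c)σy`.
lemma conductor_mul_displacement {x c : 𝓞 K} (hc : c ∈ conductor (𝓞 L) x) (σ : K ≃ₐ[L] K) {y : 𝓞 K}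
    (hy : y ∈ displacementIdeal (fun z : 𝓞 K ↦ σ • z)) : x - σ • x ∣ c * y := by
  have hadj : ∀ z ∈ Algebra.adjoin (𝓞 L) {x}, x - σ • x ∣ σ • z - z := by
    intro z hz
    induction hz using Algebra.adjoin_induction with
    | mem z hz =>
      rw [Set.mem_singleton_iff] at hz
      subst hz
      rw [dvd_sub_comm]
    | algebraMap r =>
      have : σ • algebraMap (𝓞 L) (𝓞 K) r = algebraMap (𝓞 L) (𝓞 K) r := by
        apply FaithfulSMul.algebraMap_injective (𝓞 K) K
        exact σ.commutes (r : L)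
      rw [this, sub_self]
      exact dvd_zero _
    | add a b _ _ ha hb =>
      rw [smul_add, add_sub_add_comm]
      exact dvd_add ha hb
    | mul a b _ _ ha hb =>
      have : σ • (a * b) - a * b = (σ • a - a) * (σ • b) + a * (σ • b - b) := by
        rw [smul_mul']; ring
      rw [this]
      exact dvd_add (ha.mul_right _) (hb.mul_left _)
  induction hy using Submodule.span_induction with
  | mem y hy =>
    obtain ⟨y, rfl⟩ := hy
    have h1 := hadj _ (hc y)
    have h2 := hadj _ (conductor_subset_adjoin hc)
    have : c * (σ • y - y) = (σ • (c * y) - c * y) - (σ • c - c) * (σ • y) := by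
      rw [smul_mul']; ring
    simp only [this]
    exact dvd_sub h1 (h2.mul_right _)
  | zero => simp
  | add a b _ _ ha hb => rw [mul_add]; exact dvd_add ha hb
  | smul r a _ ha =>
    rw [smul_eq_mul, mul_left_comm]
    exact ha.mul_left _

/-- Hilbert's formula for the different of a Galois extension. -/
theorem differentIdeal_eq_prod_displacementIdeal [Fintype (K ≃ₐ[L] K)]
    [DecidableEq (K ≃ₐ[L] K)] :
    differentIdeal (𝓞 L) (𝓞 K) =
      ∏ σ ∈ Finset.univ.erase (1 : K ≃ₐ[L] K), displacementIdeal (fun z : 𝓞 K ↦ σ • z) := by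
  have hex : ∀ P : Ideal (𝓞 K), P.IsMaximal → ∃ x c : 𝓞 K, c ∈ conductor (𝓞 L) x ∧ c ∉ P := by
    intro P hP
    have hP0 : P ≠ ⊥ := Ring.ne_bot_of_isMaximal_of_not_isField hP (RingOfIntegers.not_isField K)
    obtain ⟨x, hx⟩ := exists_not_conductor_le (A := 𝓞 L) hP0 (Ideal.finiteQuotientOfFreeOfNeBot P hP0)
    obtain ⟨c, hc, hcP⟩ := SetLike.not_le_iff_exists.mp hx
    exact ⟨x, c, hc, hcP⟩
  have hformula : ∀ x c : 𝓞 K, c ∈ conductor (𝓞 L) x → c ≠ 0 →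
      conductor (𝓞 L) x * differentIdeal (𝓞 L) (𝓞 K) =
        Ideal.span {∏ σ ∈ Finset.univ.erase (1 : K ≃ₐ[L] K), (x - σ • x)} := by
    intro x c hc hc0
    have hx := adjoin_eq_top_of_mem_conductor hc hc0
    rw [conductor_mul_differentIdeal (𝓞 L) L K x hx, aeval_derivative_minpoly_eq_prod hx]
  apply le_antisymm
  · refine ideal_le_of_forall_exists_mul_mem fun P hP ↦ ?_
    obtain ⟨x, c, hc, hcP⟩ := hex P hP
    have hc0 : c ≠ 0 := fun h ↦ hcP (h ▸ zero_mem P)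
    refine ⟨c, hcP, fun y hy ↦ ?_⟩
    have h1 := Ideal.mul_mem_mul hc hy
    rw [hformula x c hc hc0, Ideal.mem_span_singleton] at h1
    refine Ideal.mem_of_dvd _ h1 (Ideal.prod_mem_prod fun σ _ ↦ ?_)
    rw [← neg_sub, neg_mem_iff]
    exact Ideal.subset_span ⟨x, rfl⟩
  · refine ideal_le_of_forall_exists_mul_mem fun P hP ↦ ?_
    obtain ⟨x, c, hc, hcP⟩ := hex P hP
    have hc0 : c ≠ 0 := fun h ↦ hcP (h ▸ zero_mem P)
    -- One factor `c` is spent on each `σ ≠ 1`.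
    refine ⟨c ^ (Finset.univ.erase (1 : K ≃ₐ[L] K)).card, fun h ↦ hcP (hP.isPrime.mem_of_pow_mem _ h),
      fun y hy ↦ ?_⟩
    have hle : Ideal.span {c ^ (Finset.univ.erase (1 : K ≃ₐ[L] K)).card} *
        ∏ σ ∈ Finset.univ.erase (1 : K ≃ₐ[L] K), displacementIdeal (fun z : 𝓞 K ↦ σ • z) ≤
        conductor (𝓞 L) x * differentIdeal (𝓞 L) (𝓞 K) := by
      rw [hformula x c hc hc0, ← Ideal.span_singleton_pow, ← Finset.prod_const,
        ← Finset.prod_mul_distrib, ← Ideal.prod_span_singleton]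
      refine Finset.prod_le_prod' fun σ _ ↦ ?_
      rw [Ideal.span_singleton_mul_le_iff]
      exact fun z hz ↦ Ideal.mem_span_singleton.mpr (conductor_mul_displacement hc σ hz)
    exact Ideal.mul_le_right (hle (Ideal.mul_mem_mul (Ideal.mem_span_singleton_self _) hy))

end Different

/-! ### Discriminants of the intermediate fields -/

section Discriminants

open NumberField

/-- The automorphism `h` carries the ideal of `g` onto that of `hgh⁻¹`. This makes the norm a class
function of `g`. -/
lemma absNorm_displacementIdeal_conj {R G : Type*} [CommRing R] [IsDedekindDomain R]
    [Module.Free ℤ R] [Group G] [MulSemiringAction G R] (g h : G) :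
    (displacementIdeal fun x : R ↦ (h * g * h⁻¹) • x).absNorm =
      (displacementIdeal fun x : R ↦ g • x).absNorm := by
  let f : R ≃+* R := MulSemiringAction.toRingEquiv G R h
  have hmap : (displacementIdeal fun x : R ↦ (h * g * h⁻¹) • x) =
      (displacementIdeal fun x : R ↦ g • x).map (f : R →+* R) := by
    rw [displacementIdeal, displacementIdeal, Ideal.map_span, ← Set.range_comp]
    congr 1
    ext y
    simp only [Set.mem_range, Function.comp_apply]
    constructor
    · rintro ⟨x, rfl⟩
      exact ⟨h⁻¹ • x, by simp [f, smul_sub, mul_smul]⟩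
    · rintro ⟨x, rfl⟩
      exact ⟨h • x, by simp [f, smul_sub, mul_smul]⟩
  rw [Ideal.absNorm_apply, Ideal.absNorm_apply, Submodule.cardQuot_apply, Submodule.cardQuot_apply]
  exact (Nat.card_congr (Ideal.quotientEquiv _ _ f hmap).toEquiv).symm

variable {k K : Type*} [Field k] [NumberField k] [Field K] [NumberField K] [Algebra k K]

omit [NumberField k] in
lemma absNorm_displacementIdeal_ne_zero {g : K ≃ₐ[k] K} (hg : g ≠ 1) :
    (displacementIdeal fun x : 𝓞 K ↦ g • x).absNorm ≠ 0 := by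
  rw [Ne, Ideal.absNorm_eq_zero_iff]
  intro h
  refine hg (AlgEquiv.ext fun y ↦ ?_)
  have hfix : ∀ a : 𝓞 K, g (a : K) = a := by
    intro a
    have : g • a - a ∈ (displacementIdeal fun x : 𝓞 K ↦ g • x) := Ideal.subset_span ⟨a, rfl⟩
    rw [h, Ideal.mem_bot, sub_eq_zero] at this
    exact congrArg (algebraMap (𝓞 K) K) this
  obtain ⟨a, b, -, rfl⟩ := IsFractionRing.div_surjective (A := 𝓞 K) y
  rw [map_div₀, hfix, hfix, AlgEquiv.one_apply]

variable [IsGalois k K]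

lemma log_natAbs_discr [Fintype (K ≃ₐ[k] K)] [DecidableEq (K ≃ₐ[k] K)] :
    Real.log (discr K).natAbs =
      ∑ σ ∈ Finset.univ.erase (1 : K ≃ₐ[k] K),
        Real.log (displacementIdeal fun x : 𝓞 K ↦ σ • x).absNorm +
      Nat.card (K ≃ₐ[k] K) * Real.log (discr k).natAbs := by
  have h := natAbs_discr_eq_absNorm_differentIdeal_mul_natAbs_discr_pow k (𝓞 k) K (𝓞 K)
  rw [differentIdeal_eq_prod_displacementIdeal, map_prod, ← IsGalois.card_aut_eq_finrank] at h
  have hne : ∀ σ ∈ Finset.univ.erase (1 : K ≃ₐ[k] K),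
      ((displacementIdeal fun x : 𝓞 K ↦ σ • x).absNorm : ℝ) ≠ 0 := fun σ hσ ↦
    Nat.cast_ne_zero.mpr (absNorm_displacementIdeal_ne_zero (Finset.ne_of_mem_erase hσ))
  have hd : ((discr k).natAbs : ℝ) ≠ 0 :=
    Nat.cast_ne_zero.mpr (Int.natAbs_ne_zero.mpr (discr_ne_zero k))
  rw [h, Nat.cast_mul, Nat.cast_prod, Nat.cast_pow,
    Real.log_mul (Finset.prod_ne_zero_iff.mpr hne) (pow_ne_zero _ hd), Real.log_prod hne,
    Real.log_pow]

/-- The absolute values of the discriminants of the intermediate fields are the exponentials of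
the means of a class function. -/
theorem isMeanExp_natAbs_discr [Fintype (K ≃ₐ[k] K)] :
    IsMeanExp fun H : Subgroup (K ≃ₐ[k] K) ↦
      ((discr (IntermediateField.fixedField H)).natAbs : ℂ) := by
  classical
  -- Summed over `H`, this is `log |Δ_K|` minus the log-norm of the different of `K/K^H`, which is
  -- `|H| log |Δ_{K^H}|` by the tower formula.
  let φ : (K ≃ₐ[k] K) → ℝ := fun g ↦ if g = 1 then Real.log (discr K).natAbs else
    -Real.log (displacementIdeal fun x : 𝓞 K ↦ g • x).absNorm
  refine ⟨fun g ↦ (φ g : ℂ), fun g h ↦ ?_, fun H ↦ ?_⟩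
  · have : h * g * h⁻¹ = 1 ↔ g = 1 := conj_eq_one_iff
    simp only [φ, this, absNorm_displacementIdeal_conj]
  · set L := IntermediateField.fixedField H with hL
    let e : H ≃* (K ≃ₐ[L] K) := IntermediateField.subgroupEquivAlgEquiv H
    have he : ∀ h : H, ∀ x : 𝓞 K, e h • x = (h : K ≃ₐ[k] K) • x := fun h x ↦ rfl
    have hsum : ∑ g : K ≃ₐ[k] K, (H : Set (K ≃ₐ[k] K)).indicator (fun g ↦ (φ g : ℂ)) g =
        ((∑ h : H, φ h : ℝ) : ℂ) := by
      have h : ∀ g, (H : Set (K ≃ₐ[k] K)).indicator (fun g ↦ (φ g : ℂ)) g =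
          if g ∈ H then (φ g : ℂ) else 0 := fun g ↦ Set.indicator_apply _ _ _
      simp_rw [h]
      rw [← Finset.sum_filter, Complex.ofReal_sum]
      exact Finset.sum_subtype _ (by simp) _
    have hsum2 : ∑ h : H, φ h = ∑ σ : K ≃ₐ[L] K,
        if σ = 1 then Real.log (discr K).natAbs else
          -Real.log (displacementIdeal fun x : 𝓞 K ↦ σ • x).absNorm := by
      refine Fintype.sum_equiv e.toEquiv _ _ fun h ↦ ?_
      have h1 : e h = 1 ↔ (h : K ≃ₐ[k] K) = 1 := by
        rw [map_eq_one_iff e e.injective, OneMemClass.coe_eq_one]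
      simp only [φ, MulEquiv.toEquiv_eq_coe, EquivLike.coe_coe, h1, he]
    have hlog := log_natAbs_discr (k := L) (K := K)
    have hsum3 : ∑ h : H, φ h = Nat.card H * Real.log (discr L).natAbs := by
      rw [hsum2, ← Finset.add_sum_erase _ _ (Finset.mem_univ (1 : K ≃ₐ[L] K)), if_pos rfl,
        Finset.sum_congr rfl fun σ hσ ↦ if_neg (Finset.ne_of_mem_erase hσ),
        Finset.sum_neg_distrib, hlog, Nat.card_congr e.toEquiv]
      ring
    have hc : (Nat.card H : ℂ) ≠ 0 := by exact_mod_cast Nat.card_pos.ne'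
    have hd : (0 : ℝ) < (discr L).natAbs :=
      Nat.cast_pos.mpr (Int.natAbs_pos.mpr (discr_ne_zero L))
    rw [subgroupMean, hsum, hsum3, Complex.ofReal_mul, Complex.ofReal_natCast,
      inv_mul_cancel_left₀ hc, ← Complex.ofReal_exp, Real.exp_log hd, Complex.ofReal_natCast]

lemma tracePairing_apply (a b : 𝓞 K) :
    tracePairing K a b = ((Algebra.trace ℚ K ((a : K) * b) : ℚ) : ℂ) := by
  have := trace_eq_sum_embeddings (K := ℚ) (L := K) ℂ (x := (a : K) * b)
  rw [eq_ratCast] at this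
  rw [this]
  change ∑ τ : K →+* ℂ, τ (a : K) * τ (b : K) = _
  refine Fintype.sum_equiv (RingHom.equivRatAlgHom K ℂ) _ _ fun τ ↦ ?_
  rw [map_mul]
  rfl

omit [IsGalois k K] in
lemma isInvariantPairing_tracePairing :
    IsInvariantPairing (ringOfIntegersRep k K) (tracePairing K) := by
  intro g x y
  rw [tracePairing_apply, tracePairing_apply]
  congr 1
  have h : ((ringOfIntegersRep k K g x : 𝓞 K) : K) * (ringOfIntegersRep k K g y : 𝓞 K) =
      (g.restrictScalars ℚ) ((x : K) * y) := by
    rw [map_mul]; rfl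
  rw [h, Algebra.trace_eq_of_algEquiv]

omit [NumberField k] [NumberField K] [IsGalois k K] in
lemma mem_fixedBy_ringOfIntegersRep (H : Subgroup (K ≃ₐ[k] K)) (x : 𝓞 K) :
    x ∈ fixedBy (ringOfIntegersRep k K) H ↔ (x : K) ∈ IntermediateField.fixedField H := by
  rw [IntermediateField.mem_fixedField_iff]
  constructor
  · intro h f hf
    exact congrArg (algebraMap (𝓞 K) K) (h ⟨f, hf⟩)
  · intro h f
    exact RingOfIntegers.ext (h f f.2)

/-- The invariants of the ring of integers are the ring of integers of the fixed field. -/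
def fixedByEquiv (H : Subgroup (K ≃ₐ[k] K)) :
    𝓞 (IntermediateField.fixedField H) ≃ₗ[ℤ] fixedBy (ringOfIntegersRep k K) H :=
  LinearEquiv.ofBijective
    ((Algebra.linearMap (𝓞 (IntermediateField.fixedField H)) (𝓞 K)).restrictScalars ℤ
      |>.codRestrict _ fun x ↦ (mem_fixedBy_ringOfIntegersRep H _).mpr
        (SetLike.coe_mem (x : IntermediateField.fixedField H)))
    (by
      constructor
      · intro x y h
        exact FaithfulSMul.algebraMap_injective (𝓞 (IntermediateField.fixedField H)) (𝓞 K)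
          (congrArg Subtype.val h)
      · rintro ⟨x, hx⟩
        rw [mem_fixedBy_ringOfIntegersRep] at hx
        have hint : IsIntegral ℤ (⟨x, hx⟩ : IntermediateField.fixedField H) :=
          (isIntegral_algebraMap_iff (algebraMap (IntermediateField.fixedField H) K).injective).mp
            x.isIntegral_coe
        exact ⟨⟨⟨x, hx⟩, hint⟩, rfl⟩)

/-- On elements of `K^H` the trace from `K` is `|H|` times the trace from `K^H`, which cancels the
normalisation `|H|⁻¹`. -/
theorem fixedDet_tracePairing (H : Subgroup (K ≃ₐ[k] K)) :
    fixedDet (ringOfIntegersRep k K) (tracePairing K) H =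
      (discr (IntermediateField.fixedField H) : ℂ) := by
  classical
  set L := IntermediateField.fixedField H with hL
  let b := RingOfIntegers.basis L
  rw [fixedDet, pairingDet_eq_det _ _ (b.map (fixedByEquiv H)), discr, Algebra.discr,
    ← eq_intCast (Int.castRingHom ℂ),
    RingHom.map_det]
  congr 1
  ext i j
  have hc : (Nat.card H : ℂ) ≠ 0 := by exact_mod_cast Nat.card_pos.ne'
  have hmul : ((fixedByEquiv H (b i) : 𝓞 K) : K) * (fixedByEquiv H (b j) : 𝓞 K) =
      algebraMap L K ((b i : L) * (b j : L)) := by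
    rw [map_mul]; rfl
  have htr : Algebra.trace ℚ K (algebraMap L K ((b i : L) * (b j : L))) =
      Nat.card H * (Algebra.trace ℤ (𝓞 L) (b i * b j) : ℚ) := by
    rw [← Algebra.trace_trace (S := L), Algebra.trace_algebraMap, map_nsmul,
      IntermediateField.finrank_fixedField_eq_card, nsmul_eq_mul, ← map_mul,
      Algebra.trace_localization ℤ (nonZeroDivisors ℤ)]
    rfl
  rw [Matrix.of_apply, LinearMap.smul_apply, LinearMap.smul_apply, Module.Basis.map_apply,
    Module.Basis.map_apply, tracePairing_apply, hmul, htr, RingHom.mapMatrix_apply,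
    Matrix.map_apply, Algebra.traceMatrix_apply, Algebra.traceForm_apply]
  push_cast
  rw [smul_eq_mul, inv_mul_cancel_left₀ hc]
  rfl

end Discriminants

/-! ### The standard pairing on a free `ℤ[G]`-module -/

section FreeModule

variable (G : Type*) [Group G] (n : ℕ)

/-- The coordinates of the free `ℤ[G]`-module of rank `n`. -/
def freeCoord [Finite G] : (Fin n →₀ MonoidAlgebra ℤ G) ≃ₗ[ℤ] (Fin n × G → ℤ) :=
  (Finsupp.linearEquivFunOnFinite ℤ (MonoidAlgebra ℤ G) (Fin n)).trans <|
    (LinearEquiv.piCongrRight fun _ ↦ (MonoidAlgebra.coeffLinearEquiv ℤ).trans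
      (Finsupp.linearEquivFunOnFinite ℤ ℤ G)).trans (LinearEquiv.curry ℤ ℤ (Fin n) G).symm

variable {G n}

lemma freeCoord_free [Finite G] (h : G) (x : Fin n →₀ MonoidAlgebra ℤ G) (a : Fin n) (g : G) :
    freeCoord G n (Representation.free ℤ G (Fin n) h x) (a, g) = freeCoord G n x (a, h⁻¹ * g) := by
  have h1 : ∀ (y : Fin n →₀ MonoidAlgebra ℤ G) (g : G), freeCoord G n y (a, g) = (y a).coeff g :=
    fun _ _ ↦ rfl
  have h2 : Representation.free ℤ G (Fin n) h x a = Representation.leftRegular ℤ G h (x a) := by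
    induction x using Finsupp.induction_linear with
    | zero => simp
    | add x y hx hy => simp only [map_add, Finsupp.add_apply, hx, hy]
    | single b y =>
      rw [Representation.finsupp_single]
      by_cases hb : b = a
      · subst hb; simp
      · simp [Finsupp.single_eq_of_ne' hb]
  rw [h1, h1, h2, Representation.coeff_ofMulAction]
  rfl

variable [Fintype G]

/-- The pairing for which the elements of `G` form an orthonormal basis of `ℤ[G]`. -/
def freePairing : (Fin n →₀ MonoidAlgebra ℤ G) →ₗ[ℤ] (Fin n →₀ MonoidAlgebra ℤ G) →ₗ[ℤ] ℂ :=
  LinearMap.mk₂ ℤ (fun x y ↦ ((∑ p, freeCoord G n x p * freeCoord G n y p : ℤ) : ℂ))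
    (by intro a b c; simp [add_mul, Finset.sum_add_distrib])
    (by intro m a b; simp [Finset.mul_sum, mul_assoc])
    (by intro a b c; simp [mul_add, Finset.sum_add_distrib])
    (by intro m a b; simp [Finset.mul_sum, mul_left_comm])

lemma freePairing_apply (x y : Fin n →₀ MonoidAlgebra ℤ G) :
    freePairing x y = ((∑ p, freeCoord G n x p * freeCoord G n y p : ℤ) : ℂ) := rfl

lemma isInvariantPairing_freePairing :
    IsInvariantPairing (Representation.free ℤ G (Fin n)) freePairing := by
  intro h x y
  rw [freePairing_apply, freePairing_apply]
  congr 1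
  refine Fintype.sum_equiv ((Equiv.refl _).prodCongr (Equiv.mulLeft h⁻¹)) _ _ fun p ↦ ?_
  obtain ⟨a, g⟩ := p
  rw [freeCoord_free, freeCoord_free]
  rfl

lemma sum_inv_coset (H : Subgroup G) [Fintype (G ⧸ H)] (F : G ⧸ H → ℤ) :
    ∑ g : G, F ((g⁻¹ : G) : G ⧸ H) = Nat.card H * ∑ c, F c := by
  classical
  have h1 : ∑ g : G, F ((g⁻¹ : G) : G ⧸ H) = ∑ p : (G ⧸ H) × H, F p.1 :=
    Fintype.sum_equiv ((Equiv.inv G).trans (Subgroup.groupEquivQuotientProdSubgroup (s := H))) _ _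
      fun g ↦ rfl
  rw [h1, Fintype.sum_prod_type]
  simp only [Finset.sum_const, Finset.card_univ, nsmul_eq_mul, ← Finset.mul_sum,
    Nat.card_eq_fintype_card]

/-- The invariants of the free module are the functions on the cosets. -/
def freeFixedEquiv (H : Subgroup G) :
    (Fin n × (G ⧸ H) → ℤ) ≃ₗ[ℤ] fixedBy (Representation.free ℤ G (Fin n)) H :=
  LinearEquiv.ofBijective
    (((freeCoord G n).symm.toLinearMap ∘ₗ LinearMap.funLeft ℤ ℤ
      -- Left translation makes invariants constant on the cosets `Hg`; inversion turns these into
      -- points of `G ⧸ H`.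
      (fun p : Fin n × G ↦ (p.1, ((p.2⁻¹ : G) : G ⧸ H)))).codRestrict
        (fixedBy (Representation.free ℤ G (Fin n)) H) fun F h ↦ by
        apply (freeCoord G n).injective
        ext ⟨a, g⟩
        refine (freeCoord_free (h : G) _ a g).trans ?_
        simp only [LinearMap.comp_apply, LinearEquiv.coe_coe, LinearEquiv.apply_symm_apply,
          LinearMap.funLeft_apply]
        congr 2
        rw [QuotientGroup.eq]
        simp)
    (by
      constructor
      · intro F F' h
        have h' := (freeCoord G n).symm.injective (congrArg Subtype.val h)
        ext ⟨a, c⟩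
        obtain ⟨g, rfl⟩ := QuotientGroup.mk_surjective c
        simpa [LinearMap.funLeft_apply] using congrFun h' (a, g⁻¹)
      · rintro ⟨x, hx⟩
        refine ⟨fun p ↦ freeCoord G n x (p.1, p.2.out⁻¹), Subtype.ext ?_⟩
        apply (freeCoord G n).injective
        ext ⟨a, g⟩
        change freeCoord G n ((freeCoord G n).symm _) (a, g) = _
        rw [LinearEquiv.apply_symm_apply, LinearMap.funLeft_apply]
        obtain ⟨h, hh⟩ := QuotientGroup.mk_out_eq_mul H g⁻¹
        have := congrArg (fun z ↦ freeCoord G n z (a, g)) (hx h)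
        refine Eq.trans ?_ this
        refine Eq.trans ?_ (freeCoord_free (h : G) x a g).symm
        simp only [hh, mul_inv_rev, inv_inv])

lemma freeCoord_freeFixedEquiv (H : Subgroup G) (F : Fin n × (G ⧸ H) → ℤ) (p : Fin n × G) :
    freeCoord G n (freeFixedEquiv H F : Fin n →₀ MonoidAlgebra ℤ G) p =
      F (p.1, ((p.2⁻¹ : G) : G ⧸ H)) := by
  change freeCoord G n ((freeCoord G n).symm _) p = _
  rw [LinearEquiv.apply_symm_apply]
  rfl

instance : Module.Finite ℤ (Fin n →₀ MonoidAlgebra ℤ G) :=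
  Module.Finite.equiv (freeCoord G n).symm

instance : Module.Free ℤ (Fin n →₀ MonoidAlgebra ℤ G) :=
  Module.Free.of_equiv (freeCoord G n).symm

/-- Indicators of cosets form an orthogonal basis of the invariants, each of square length `|H|`. -/
lemma fixedDet_freePairing (H : Subgroup G) :
    fixedDet (Representation.free ℤ G (Fin n)) freePairing H = 1 := by
  classical
  have := Fintype.ofFinite (G ⧸ H)
  let b := (Pi.basisFun ℤ (Fin n × (G ⧸ H))).map (freeFixedEquiv H)
  rw [fixedDet, pairingDet_eq_det _ _ b, ← Matrix.det_one (n := Fin n × (G ⧸ H))]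
  congr 1
  ext p q
  have hc : (Nat.card H : ℂ) ≠ 0 := by exact_mod_cast Nat.card_pos.ne'
  rw [Matrix.of_apply, LinearMap.smul_apply, LinearMap.smul_apply, freePairing_apply]
  simp only [b, Module.Basis.map_apply, freeCoord_freeFixedEquiv]
  rw [Fintype.sum_prod_type]
  have h1 : ∀ a : Fin n, ∑ g : G, (Pi.basisFun ℤ (Fin n × (G ⧸ H)) p (a, ((g⁻¹ : G) : G ⧸ H)) *
      Pi.basisFun ℤ (Fin n × (G ⧸ H)) q (a, ((g⁻¹ : G) : G ⧸ H))) =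
      Nat.card H * ∑ c : G ⧸ H, (Pi.basisFun ℤ (Fin n × (G ⧸ H)) p (a, c) *
      Pi.basisFun ℤ (Fin n × (G ⧸ H)) q (a, c)) := fun a ↦ sum_inv_coset H fun c ↦
        (Pi.basisFun ℤ (Fin n × (G ⧸ H)) p (a, c) * Pi.basisFun ℤ (Fin n × (G ⧸ H)) q (a, c))
  simp only [h1]
  rw [← Finset.mul_sum, ← Fintype.sum_prod_type'
    (f := fun a c ↦ Pi.basisFun ℤ (Fin n × (G ⧸ H)) p (a, c) *
      Pi.basisFun ℤ (Fin n × (G ⧸ H)) q (a, c))]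
  push_cast
  rw [smul_eq_mul, inv_mul_cancel_left₀ hc]
  simp only [Pi.basisFun_apply, Pi.single_apply, Matrix.one_apply]
  by_cases h : p = q
  · subst h; simp
  · rw [if_neg h]
    refine Finset.sum_eq_zero fun r _ ↦ ?_
    by_cases hr : r = p
    · subst hr; simp [h]
    · simp [hr]

end FreeModule

/-! ### Indices as regulator determinants -/

section IndexFunctions

variable {G M N : Type*} [Group G] [AddCommGroup M] [AddCommGroup N]
  [Module.Free ℤ M] [Module.Finite ℤ M] {ρ : Representation ℤ G M} {σ : Representation ℤ G N}

omit [Module.Free ℤ M] in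
lemma fixedDet_bot (B : M →ₗ[ℤ] M →ₗ[ℤ] ℂ) : fixedDet ρ B ⊥ = pairingDet B ⊤ := by
  have h1 : fixedBy ρ ⊥ = ⊤ := by
    rw [eq_top_iff]
    rintro x - ⟨g, hg⟩
    rw [Subgroup.mem_bot] at hg
    subst hg
    exact congrArg (fun f ↦ f x) ρ.map_one
  rw [fixedDet, h1]
  simp

omit [Module.Finite ℤ M] in
lemma FiniteKerCoker.injective {i : ρ.IntertwiningMap σ} (hi : FiniteKerCoker i) :
    Function.Injective i.toLinearMap := by
  rw [← LinearMap.ker_eq_bot, Submodule.eq_bot_iff]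
  intro x hx
  have := hi.1
  have h := congrArg Subtype.val (card_nsmul_eq_zero' (x := (⟨x, hx⟩ : LinearMap.ker i.toLinearMap)))
  change Nat.card (LinearMap.ker i.toLinearMap) • x = 0 at h
  rw [← Nat.cast_smul_eq_nsmul ℤ] at h
  exact (smul_eq_zero.mp h).resolve_left (Nat.cast_ne_zero.mpr Nat.card_pos.ne')

omit [Module.Free ℤ M] [Module.Finite ℤ M] in
lemma fixedBy_eq_comap {i : ρ.IntertwiningMap σ} (hi : Function.Injective i.toLinearMap)
    (H : Subgroup G) : fixedBy ρ H = (fixedBy σ H).comap i.toLinearMap := by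
  ext x
  constructor
  · intro h g
    exact (Representation.IntertwiningMap.isIntertwining ρ σ i _ _).symm.trans (congrArg i.toLinearMap (h g))
  · intro h g
    exact hi ((Representation.IntertwiningMap.isIntertwining ρ σ i _ _).trans (h g))

omit [Module.Finite ℤ M] in
lemma indexQuotient_eq {i : ρ.IntertwiningMap σ} (hi : FiniteKerCoker i) (H : Subgroup G) :
    indexQuotient i H = ((((fixedBy σ H).comap i.toLinearMap).map
      i.toLinearMap).toAddSubgroup.relIndex (fixedBy σ H).toAddSubgroup : ℚ) := by
  rw [indexQuotient, LinearMap.ker_eq_bot.mpr hi.injective, bot_inf_eq,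
    ← fixedBy_eq_comap hi.injective]
  simp

omit [Module.Finite ℤ M] in
lemma indexQuotient_pos {i : ρ.IntertwiningMap σ} (hi : FiniteKerCoker i) (H : Subgroup G) :
    0 < indexQuotient i H := by
  rw [indexQuotient_eq hi]
  exact_mod_cast Nat.pos_of_ne_zero (relIndex_map_comap_ne_zero hi.2 (fixedBy σ H))

variable [Module.Free ℤ N] [Module.Finite ℤ N]

/-- The regulator determinants of a pairing and of its pull-back differ by the square of the
index. -/
lemma fixedDet_compl₁₂ {i : ρ.IntertwiningMap σ} (hi : FiniteKerCoker i)
    (B : N →ₗ[ℤ] N →ₗ[ℤ] ℂ) (H : Subgroup G) :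
    fixedDet ρ (B.compl₁₂ i.toLinearMap i.toLinearMap) H =
      (indexQuotient i H : ℂ) ^ 2 * fixedDet σ B H := by
  rw [indexQuotient_eq hi, fixedDet, fixedDet, Rat.cast_natCast, fixedBy_eq_comap hi.injective]
  exact pairingDet_compl₁₂ ((Nat.card H : ℂ)⁻¹ • B) hi.injective hi.2 _

lemma FiniteKerCoker.rationallyIsomorphic {i : ρ.IntertwiningMap σ} (hi : FiniteKerCoker i) :
    RationallyIsomorphic ρ σ := by
  have hinj : Function.Injective (i.toLinearMap.baseChange ℚ) :=
    Module.Flat.lTensor_preserves_injective_linearMap _ hi.injective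
  have hrank : Module.finrank ℚ (ℚ ⊗[ℤ] M) = Module.finrank ℚ (ℚ ⊗[ℤ] N) := by
    rw [Module.finrank_baseChange, Module.finrank_baseChange, ← finrank_top (R := ℤ) (M := N),
      ← finrank_comap_eq hi.injective hi.2, Submodule.comap_top, finrank_top]
  refine ⟨LinearEquiv.ofBijective _ ⟨hinj,
    (LinearMap.injective_iff_surjective_of_finrank_eq_finrank hrank).mp hinj⟩, fun g x ↦ ?_⟩
  change (i.toLinearMap.baseChange ℚ ∘ₗ (ρ g).baseChange ℚ) x =
    ((σ g).baseChange ℚ ∘ₗ i.toLinearMap.baseChange ℚ) x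
  rw [← LinearMap.baseChange_comp, ← LinearMap.baseChange_comp]
  congr 2
  exact LinearMap.ext fun y ↦ Representation.IntertwiningMap.isIntertwining ρ σ i g y

end IndexFunctions

/-! ### The ring of integers -/

section RingOfIntegers

open NumberField

variable (k K : Type*) [Field k] [NumberField k] [Field K] [NumberField K] [Algebra k K]
  [IsGalois k K]

/-- A `ℚ`-basis of `K` which is permuted freely by the Galois group. -/
lemma exists_basis_permuted : ∃ b : Module.Basis (Fin (Module.finrank ℚ k) × (K ≃ₐ[k] K)) ℚ K,
    ∀ (h : K ≃ₐ[k] K) a g, h (b (a, g)) = b (a, h * g) := by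
  refine ⟨(Module.finBasis ℚ k).smulTower (IsGalois.normalBasis k K), fun h a g ↦ ?_⟩
  rw [Module.Basis.smulTower_apply, Module.Basis.smulTower_apply, Algebra.smul_def,
    Algebra.smul_def, map_mul, h.commutes]
  congr 1
  rw [IsGalois.normalBasis_apply g, IsGalois.normalBasis_apply (h * g)]
  rfl

/-- The ring of integers is isogenous to a free module over the group ring. -/
lemma exists_finiteKerCoker :
    ∃ i : (ringOfIntegersRep k K).IntertwiningMap
      (Representation.free ℤ (K ≃ₐ[k] K) (Fin (Module.finrank ℚ k))), FiniteKerCoker i := by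
  classical
  obtain ⟨b, hb⟩ := exists_basis_permuted k K
  let e := RingOfIntegers.basis K
  -- `d` is a common denominator for the coordinates of an integral basis, so `d` times the
  -- coordinate map sends `𝓞 K` to integer vectors. Its cokernel is finite since the ranks agree.
  obtain ⟨d, hd⟩ := IsLocalization.exist_integer_multiples_of_finite (nonZeroDivisors ℤ)
    (fun p : Module.Free.ChooseBasisIndex ℤ (𝓞 K) × Fin (Module.finrank ℚ k) × (K ≃ₐ[k] K) ↦
      b.repr (algebraMap (𝓞 K) K (e p.1)) p.2)
  have hd0 : ((d : ℤ) : ℚ) ≠ 0 := Int.cast_ne_zero.mpr (nonZeroDivisors.coe_ne_zero d)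
  choose z hz using hd
  have hex : ∀ (x : 𝓞 K) p, ∃ m : ℤ, (m : ℚ) = (d : ℤ) * b.repr (algebraMap (𝓞 K) K x) p := by
    intro x p
    refine ⟨∑ j, e.repr x j * z (j, p), ?_⟩
    have hx : algebraMap (𝓞 K) K x = ∑ j, (e.repr x j : ℚ) • algebraMap (𝓞 K) K (e j) := by
      conv_lhs => rw [← e.sum_repr x, map_sum]
      refine Finset.sum_congr rfl fun j _ ↦ ?_
      rw [map_zsmul, Int.cast_smul_eq_zsmul]
    rw [hx, map_sum, Finsupp.finsetSum_apply, Finset.mul_sum]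
    push_cast
    refine Finset.sum_congr rfl fun j _ ↦ ?_
    have := hz (j, p)
    rw [eq_intCast] at this
    rw [this, zsmul_eq_mul, map_smul, Finsupp.smul_apply, smul_eq_mul]
    ring
  choose c hc using hex
  let f : 𝓞 K →ₗ[ℤ] (Fin (Module.finrank ℚ k) × (K ≃ₐ[k] K) → ℤ) := AddMonoidHom.toIntLinearMap
    { toFun := c
      map_zero' := by
        ext p
        have : (c 0 p : ℚ) = 0 := by rw [hc]; simp
        exact_mod_cast this
      map_add' := fun x y ↦ by
        ext p
        have : (c (x + y) p : ℚ) = c x p + c y p := by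
          rw [hc, hc, hc, map_add, map_add, Finsupp.add_apply, mul_add]
        exact_mod_cast this }
  have hf : ∀ x p, (f x p : ℚ) = (d : ℤ) * b.repr (algebraMap (𝓞 K) K x) p := hc
  have hfinj : Function.Injective f := by
    intro x y h
    refine RingOfIntegers.ext (b.repr.injective (Finsupp.ext fun p ↦ ?_))
    have := congrArg (fun m : ℤ ↦ (m : ℚ)) (congrFun h p)
    simp only [hf] at this
    exact mul_left_cancel₀ hd0 this
  have hrepr : ∀ (h : K ≃ₐ[k] K) (x : K) a g,
      b.repr (h x) (a, g) = b.repr x (a, h⁻¹ * g) := by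
    intro h x a g
    have hlin : (h.restrictScalars ℚ).toLinearMap x = h x := rfl
    have : (Finsupp.lapply (a, g) ∘ₗ b.repr.toLinearMap ∘ₗ (h.restrictScalars ℚ).toLinearMap) =
        Finsupp.lapply (a, h⁻¹ * g) ∘ₗ b.repr.toLinearMap := by
      refine b.ext fun ⟨a', g'⟩ ↦ ?_
      have h1 : (h.restrictScalars ℚ).toLinearMap (b (a', g')) = b (a', h * g') := hb h a' g'
      simp only [LinearMap.comp_apply, h1, LinearEquiv.coe_coe, Module.Basis.repr_self,
        Finsupp.lapply_apply, Finsupp.single_apply, Prod.mk.injEq, eq_inv_mul_iff_mul_eq]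
    exact LinearMap.congr_fun this x
  let F : 𝓞 K →ₗ[ℤ] (Fin (Module.finrank ℚ k) →₀ MonoidAlgebra ℤ (K ≃ₐ[k] K)) :=
    (freeCoord (K ≃ₐ[k] K) (Module.finrank ℚ k)).symm.toLinearMap ∘ₗ f
  have hF : ∀ x, freeCoord (K ≃ₐ[k] K) (Module.finrank ℚ k) (F x) = f x := fun x ↦
    LinearEquiv.apply_symm_apply _ _
  have hFinj : Function.Injective F := fun x y h ↦ hfinj (by rw [← hF, h, hF])
  refine ⟨⟨F, fun g ↦ ?_⟩, ?_, ?_⟩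
  · refine LinearMap.ext fun x ↦ (freeCoord _ _).injective (funext fun ⟨a, g'⟩ ↦ ?_)
    change freeCoord _ _ (F (ringOfIntegersRep k K g x)) (a, g') =
      freeCoord _ _ (Representation.free ℤ _ _ g (F x)) (a, g')
    rw [hF, freeCoord_free, hF]
    have : (f (ringOfIntegersRep k K g x) (a, g') : ℚ) = f x (a, g⁻¹ * g') := by
      rw [hf, hf, ← hrepr]
      rfl
    exact_mod_cast this
  · change Finite (LinearMap.ker F)
    rw [LinearMap.ker_eq_bot.mpr hFinj]
    infer_instance
  · change Finite (_ ⧸ LinearMap.range F)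
    rw [Submodule.finiteQuotient_iff, LinearMap.finrank_range_of_inj hFinj, RingOfIntegers.rank,
      Module.finrank_eq_card_basis b, (freeCoord _ _).finrank_eq, Module.finrank_pi]

variable {k K}

omit [NumberField k] [IsGalois k K] in
lemma nondegeneratePairing_tracePairing : NondegeneratePairing (tracePairing K) := by
  rw [NondegeneratePairing, ← fixedDet_bot (ρ := ringOfIntegersRep K K), fixedDet_tracePairing]
  exact Int.cast_ne_zero.mpr (discr_ne_zero _)

variable [Fintype (K ≃ₐ[k] K)]
  {i : (ringOfIntegersRep k K).IntertwiningMap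
    (Representation.free ℤ (K ≃ₐ[k] K) (Fin (Module.finrank ℚ k)))}

/-- The pull-back to the ring of integers of the standard pairing of a free module. -/
def pulledBackPairing (i : (ringOfIntegersRep k K).IntertwiningMap
    (Representation.free ℤ (K ≃ₐ[k] K) (Fin (Module.finrank ℚ k)))) :
    𝓞 K →ₗ[ℤ] 𝓞 K →ₗ[ℤ] ℂ :=
  freePairing.compl₁₂ i.toLinearMap i.toLinearMap

omit [IsGalois k K] in
lemma fixedDet_pulledBackPairing (hi : FiniteKerCoker i) (H : Subgroup (K ≃ₐ[k] K)) :
    fixedDet (ringOfIntegersRep k K) (pulledBackPairing i) H = (indexQuotient i H : ℂ) ^ 2 := by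
  rw [pulledBackPairing, fixedDet_compl₁₂ hi, fixedDet_freePairing, mul_one]

omit [NumberField K] [IsGalois k K] in
lemma isInvariantPairing_pulledBackPairing :
    IsInvariantPairing (ringOfIntegersRep k K) (pulledBackPairing i) := by
  intro g x y
  have h := fun z ↦ Representation.IntertwiningMap.isIntertwining _ _ i g z
  change freePairing (i _) (i _) = freePairing (i x) (i y)
  rw [h, h, isInvariantPairing_freePairing]

omit [IsGalois k K] in
lemma nondegeneratePairing_pulledBackPairing (hi : FiniteKerCoker i) :
    NondegeneratePairing (pulledBackPairing i) := by
  rw [NondegeneratePairing, ← fixedDet_bot (ρ := ringOfIntegersRep k K),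
    fixedDet_pulledBackPairing hi]
  exact pow_ne_zero _ (Rat.cast_ne_zero.mpr (indexQuotient_pos hi _).ne')

/-- The value is the square of an index, hence equals its own absolute value. Comparison with the
trace pairing thus needs only `|Δ_{K^H}|`, so the sign of the discriminant plays no part. -/
lemma isMeanExp_fixedDet_pulledBackPairing (hi : FiniteKerCoker i) :
    IsMeanExp (fixedDet (ringOfIntegersRep k K) (pulledBackPairing i)) := by
  obtain ⟨d, hd, h⟩ := exists_isMeanExp_fixedDet (isInvariantPairing_tracePairing (k := k))
    isInvariantPairing_pulledBackPairing nondegeneratePairing_tracePairing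
    (nondegeneratePairing_pulledBackPairing hi)
  convert! hd.norm.mul isMeanExp_natAbs_discr using 2 with H
  have h1 : fixedDet (ringOfIntegersRep k K) (pulledBackPairing i) H =
      ((‖fixedDet (ringOfIntegersRep k K) (pulledBackPairing i) H‖ : ℝ) : ℂ) := by
    rw [fixedDet_pulledBackPairing hi, norm_pow, ← Complex.ofReal_ratCast, Complex.norm_real,
      Real.norm_eq_abs, sq_abs, Complex.ofReal_pow]
  rw [h1, h, norm_mul, Complex.ofReal_mul, fixedDet_tracePairing, Complex.norm_intCast]
  rw [← Int.cast_abs, Complex.ofReal_intCast, Nat.cast_natAbs]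

lemma isMeanExp_indexQuotient (hi : FiniteKerCoker i) :
    IsMeanExp fun H ↦ (indexQuotient i H : ℂ) := by
  have h := isMeanExp_fixedDet_pulledBackPairing hi
  have := IsMeanExp.of_sq (r := fun H ↦ (indexQuotient i H : ℝ))
    (fun H ↦ Rat.cast_pos.mpr (indexQuotient_pos hi H)) (by
      convert! h using 2 with H
      rw [fixedDet_pulledBackPairing hi, Complex.ofReal_ratCast])
  simpa only [Complex.ofReal_ratCast] using this

/-- The regulator determinants of the ring of integers, for any invariant non-degenerate pairing,
are the exponentials of the means of a class function. -/
theorem isMeanExp_fixedDet {B : 𝓞 K →ₗ[ℤ] 𝓞 K →ₗ[ℤ] ℂ}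
    (hB : IsInvariantPairing (ringOfIntegersRep k K) B) (hn : NondegeneratePairing B) :
    IsMeanExp (fixedDet (ringOfIntegersRep k K) B) := by
  obtain ⟨i, hi⟩ := exists_finiteKerCoker k K
  -- The reference is the pulled-back pairing, whose determinants are known exactly; for the trace
  -- pairing only absolute values have been controlled so far.
  obtain ⟨d, hd, h⟩ := exists_isMeanExp_fixedDet isInvariantPairing_pulledBackPairing hB
    (nondegeneratePairing_pulledBackPairing hi) hn
  convert! hd.mul (isMeanExp_fixedDet_pulledBackPairing hi) using 2 with H
  exact h H

theorem factorEquivalent_free : FactorEquivalent (ringOfIntegersRep k K)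
    (Representation.free ℤ (K ≃ₐ[k] K) (Fin (Module.finrank ℚ k))) := by
  obtain ⟨i, hi⟩ := exists_finiteKerCoker k K
  refine ⟨hi.rationallyIsomorphic, ⟨i, hi⟩, fun j hj ↦ ?_⟩
  exact ⟨fun H ↦ Units.mk0 (indexQuotient j H) (indexQuotient_pos hj H).ne', fun H ↦ rfl,
    (isMeanExp_indexQuotient hj).factorisable⟩

end RingOfIntegers

end FactorEq

end

theorem mainTheorem6 (k K : Type*) [Field k] [NumberField k] [Field K] [NumberField K]
    [Algebra k K] [IsGalois k K] :
    FactorEq.FactorEquivalent (FactorEq.ringOfIntegersRep k K)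
      (Representation.free ℤ (K ≃ₐ[k] K) (Fin (Module.finrank ℚ k))) ∧
    (∀ Θ : Subgroup (K ≃ₐ[k] K) → ℤ, FactorEq.IsBrauerRelation Θ →
      ∀ B : NumberField.RingOfIntegers K →ₗ[ℤ] NumberField.RingOfIntegers K →ₗ[ℤ] ℂ,
        FactorEq.IsInvariantPairing (FactorEq.ringOfIntegersRep k K) B →
        FactorEq.NondegeneratePairing B →
        FactorEq.regulatorConstant (FactorEq.ringOfIntegersRep k K) B Θ = 1) ∧
    (FactorEq.IsInvariantPairing (FactorEq.ringOfIntegersRep k K) (FactorEq.tracePairing K) ∧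
      FactorEq.NondegeneratePairing (FactorEq.tracePairing K) ∧
      ∀ H : Subgroup (K ≃ₐ[k] K),
        FactorEq.fixedDet (FactorEq.ringOfIntegersRep k K) (FactorEq.tracePairing K) H =
          (NumberField.discr (IntermediateField.fixedField H) : ℂ)) ∧
    (∀ Θ : Subgroup (K ≃ₐ[k] K) → ℤ, FactorEq.IsBrauerRelation Θ →
      ∏ᶠ H : Subgroup (K ≃ₐ[k] K),
        (NumberField.discr (IntermediateField.fixedField H) : ℚ) ^ Θ H = 1) := by
  have hreg : ∀ Θ : Subgroup (K ≃ₐ[k] K) → ℤ, FactorEq.IsBrauerRelation Θ →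
      ∀ B : NumberField.RingOfIntegers K →ₗ[ℤ] NumberField.RingOfIntegers K →ₗ[ℤ] ℂ,
        FactorEq.IsInvariantPairing (FactorEq.ringOfIntegersRep k K) B →
        FactorEq.NondegeneratePairing B →
        FactorEq.regulatorConstant (FactorEq.ringOfIntegersRep k K) B Θ = 1 :=
    fun Θ hΘ B hB hn ↦ (FactorEq.isMeanExp_fixedDet hB hn).finprod_zpow_eq_one hΘ
  refine ⟨FactorEq.factorEquivalent_free, hreg, ⟨FactorEq.isInvariantPairing_tracePairing,
    FactorEq.nondegeneratePairing_tracePairing, FactorEq.fixedDet_tracePairing⟩, fun Θ hΘ ↦ ?_⟩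
  -- The discriminant relation, with signs, is the regulator constant of the trace pairing.
  have h := hreg Θ hΘ _ FactorEq.isInvariantPairing_tracePairing
    FactorEq.nondegeneratePairing_tracePairing
  rw [FactorEq.regulatorConstant, finprod_eq_prod_of_fintype] at h
  simp only [FactorEq.fixedDet_tracePairing] at h
  rw [finprod_eq_prod_of_fintype]
  refine Rat.cast_injective (α := ℂ) ?_
  push_cast
  exact h
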